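/- **Theorem 4.2 (discrete Helmholtz decomposition on squares).** Let $\Omega\subseteq\mathbb{R}^2$ be a simply connected, bounded, polygonal Lipschitz domain and let $\mathcal{T}$ be a regular partition of $\Omega$ into squares, i.e. a finite set of closed squares with $\overline\Omega=\bigcup\mathcal{T}$ such that any two distinct squares are disjoint or share exactly one common vertex or exactly one common edge. For $T\in\mathcal{T}$ let $\psi_T:\widehat T=[0,1]^2\to T$ be the bilinear transformation that maps the vertices $(0,0),(1,0),(1,1),(0,1)$ of $\widehat T$ to the vertices of $T$ (numbered cyclically). Let $\operatorname{Curl}\beta=(\partial\beta/\partial x_2,-\partial\beta/\partial x_1)$, let $\nabla_{NC}$ denote the piecewise gradient with respect to $\mathcal{T}$, let $Q_1(\widehat T)=\operatorname{span}\{1,x,y,xy\}$ and $Q^{\mathrm{rot}}(\widehat T)=\operatorname{span}\{1,x,y,x^2-y^2\}$, and define $$V_{Q,1}(\mathcal{T})=\Big\{\beta\in H^1(\Omega)\ \Big|\ \int_\Omega\beta\,dx=0,\ \forall T\in\mathcal{T}:\ (\beta\circ\psi_T)|_{\widehat T}\in Q_1(\widehat T)\Big\},$$ $$V^{\mathrm{rot}}_{NC}(\mathcal{T})=\Big\{v\in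 L^2(\Omega)\ \Big|\ \forall T\in\mathcal{T}:\ (v\circ\psi_T)|_{\widehat T}\in Q^{\mathrm{rot}}(\widehat T);\ \int_E v\,ds\text{ is continuous across every interior edge }E\text{ and vanishes on every boundary edge }E\Big\},$$ where "continuous" means that the integrals over $E$ of the traces from the two adjacent squares agree, and $$X_1^{\mathrm{rect}}(\mathcal{T})=\left\{\tau\in L^2(\Omega;\mathbb{R}^2)\ \middle|\ \begin{array}{l}\forall T\in\mathcal{T}\ \exists a\in\mathbb{R}\ \exists d\in\mathbb{R}^2:\\ (\tau\circ\psi_T)|_{\widehat T}=\begin{pmatrix}0&1\\-1&0\end{pmatrix}\big(D(\psi_T^{-1})^\top\circ\psi_T\big)\begin{pmatrix}0&-1\\1&0\end{pmatrix}\left(a\begin{pmatrix}-\widehat x\\ \widehat y\end{pmatrix}+d\right)\end{array}\right\}.$$ Then $$X_1^{\mathrm{rect}}(\mathcal{T})=\nabla_{NC}V^{\mathrm{rot}}_{NC}(\mathcal{T})\oplus\operatorname{Curl}V_{Q,1}(\mathcal{T}),$$ and the decomposition is orthogonal in $L^2(\Omega;\mathbb{R}^2)$. -/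

import Mathlib

open MeasureTheory Set
open scoped ENNReal ContDiff

/-- The Euclidean plane. -/
abbrev Plane : Type := EuclideanSpace ℝ (Fin 2)

/-- The Lebesgue space `L²(Ω; F)`. -/
abbrev L2 (Ω : Set Plane) (F : Type*) [NormedAddCommGroup F] : Type _ :=
  Lp F 2 ((volume : Measure Plane).restrict Ω)

/-! ### Domains -/

/-- Near every boundary point, `Ω` is the set of points strictly below the graph of a Lipschitz
function in some orthonormal coordinate system. -/
def HasLipschitzBoundary (Ω : Set Plane) : Prop :=
  ∀ x ∈ frontier Ω, ∃ (R : Plane ≃ₗᵢ[ℝ] Plane) (γ : ℝ → ℝ) (K : NNReal) (δ : ℝ),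
    LipschitzWith K γ ∧ 0 < δ ∧
      ∀ y ∈ Metric.ball x δ, (y ∈ Ω ↔ (R y) 1 < γ ((R y) 0))

/-! ### Quadrilateral partitions

A quadrilateral is given by its four vertices `z 0, z 1, z 2, z 3` in cyclic order (in either
orientation). A partition is a finite family of such quadrilaterals. -/

/-- The reference rectangle `[0,1]²`. -/
def refSquare : Set Plane := {x | ∀ k, x k ∈ Icc (0 : ℝ) 1}

/-- The bilinear transformation that maps the vertices `(0,0), (1,0), (1,1), (0,1)` of the reference
rectangle to `z 0, z 1, z 2, z 3`. -/
noncomputable def bilin (z : Fin 4 → Plane) (x : Plane) : Plane :=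
  ((1 - x 0) * (1 - x 1)) • z 0 + (x 0 * (1 - x 1)) • z 1 + (x 0 * x 1) • z 2
    + ((1 - x 0) * x 1) • z 3

/-- The Jacobian matrix of the bilinear transformation. -/
noncomputable def bilinJacobian (z : Fin 4 → Plane) (x : Plane) : Matrix (Fin 2) (Fin 2) ℝ :=
  Matrix.of fun k l => (fderiv ℝ (bilin z) x (EuclideanSpace.single l 1)) k

/-- The closed quadrilateral with vertices `z`. -/
def cell (z : Fin 4 → Plane) : Set Plane := bilin z '' refSquare

/-- The edge from `z p` to `z (p + 1)`; the addition in `Fin 4` is cyclic. -/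
def edge (z : Fin 4 → Plane) (p : Fin 4) : Set Plane := segment ℝ (z p) (z (p + 1))

/-- The quadrilateral is a (nondegenerate) square. -/
def IsSquareCell (z : Fin 4 → Plane) : Prop :=
  z 1 ≠ z 0 ∧ z 2 - z 3 = z 1 - z 0 ∧ inner ℝ (z 1 - z 0) (z 3 - z 0) = 0 ∧
    ‖z 1 - z 0‖ = ‖z 3 - z 0‖

/-- The family `z` is a regular partition of `Ω`: the cells cover the closure of `Ω`, and any two
distinct cells are disjoint or share exactly one vertex or exactly one edge. -/
def IsRegularPartition {ι : Type*} (Ω : Set Plane) (z : ι → Fin 4 → Plane) : Prop :=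
  closure Ω = ⋃ i, cell (z i) ∧
    ∀ i j, i ≠ j →
      cell (z i) ∩ cell (z j) = ∅ ∨
      (∃ p q, z i p = z j q ∧ cell (z i) ∩ cell (z j) = {z i p}) ∨
      (∃ p q, edge (z i) p = edge (z j) q ∧ cell (z i) ∩ cell (z j) = edge (z i) p)

/-- The integral of `v` with respect to arc length over the segment from `a` to `b`. -/
noncomputable def segmentIntegral (v : Plane → ℝ) (a b : Plane) : ℝ :=
  ‖b - a‖ * ∫ t in (0 : ℝ)..1, v (AffineMap.lineMap a b t)

/-! ### Weak derivatives -/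

/-- `g` is the weak gradient of `u` on the open set `U ⊆ Ω`. As the test functions are supported
in `U`, the integrals over `Ω` are integrals over `U`. -/
def HasWeakGradient (Ω U : Set Plane) (u : L2 Ω ℝ) (g : L2 Ω Plane) : Prop :=
  ∀ φ : Plane → ℝ, ContDiff ℝ ∞ φ → HasCompactSupport φ → tsupport φ ⊆ U →
    ∀ k : Fin 2, ∫ x in Ω, u x * fderiv ℝ φ x (EuclideanSpace.single k 1)
      = -∫ x in Ω, g x k * φ x

/-- `c = Curl β` in the weak sense on `Ω`, where `Curl β = (∂β/∂x₂, -∂β/∂x₁)`. -/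
def HasWeakCurl (Ω : Set Plane) (β : L2 Ω ℝ) (c : L2 Ω Plane) : Prop :=
  ∃ g : L2 Ω Plane, HasWeakGradient Ω Ω β g ∧ ∀ᵐ x ∂volume.restrict Ω, c x = !₂[g x 1, -g x 0]

theorem integrable_L2_mul {Ω : Set Plane} (u : L2 Ω ℝ) {ψ : Plane → ℝ} (hψ : Continuous ψ)
    (hc : HasCompactSupport ψ) : Integrable (fun x => u x * ψ x) (volume.restrict Ω) :=
  (Lp.memLp u).integrable_mul (q := 2) ((hψ.memLp_of_hasCompactSupport hc).restrict Ω)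

theorem integrable_L2_coord_mul {Ω : Set Plane} (g : L2 Ω Plane) (k : Fin 2) {ψ : Plane → ℝ}
    (hψ : Continuous ψ) (hc : HasCompactSupport ψ) :
    Integrable (fun x => g x k * ψ x) (volume.restrict Ω) := by
  have h : MemLp (fun x => g x k) 2 (volume.restrict Ω) :=
    (EuclideanSpace.proj (𝕜 := ℝ) k : Plane →L[ℝ] ℝ).comp_memLp' (Lp.memLp g)
  exact h.integrable_mul (q := 2) ((hψ.memLp_of_hasCompactSupport hc).restrict Ω)

theorem HasWeakGradient.zero (Ω U : Set Plane) : HasWeakGradient Ω U 0 0 := by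
  intro φ _ _ _ k
  have h1 : ∫ x in Ω, (0 : L2 Ω ℝ) x * fderiv ℝ φ x (EuclideanSpace.single k 1) = 0 := by
    rw [integral_eq_zero_of_ae]
    filter_upwards [Lp.coeFn_zero ℝ 2 (volume.restrict Ω)] with x hx
    rw [hx]
    simp
  have h2 : ∫ x in Ω, (0 : L2 Ω Plane) x k * φ x = 0 := by
    rw [integral_eq_zero_of_ae]
    filter_upwards [Lp.coeFn_zero Plane 2 (volume.restrict Ω)] with x hx
    rw [hx]
    simp
  rw [h1, h2, neg_zero]

theorem HasWeakGradient.add {Ω U : Set Plane} {u v : L2 Ω ℝ} {g h : L2 Ω Plane}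
    (hu : HasWeakGradient Ω U u g) (hv : HasWeakGradient Ω U v h) :
    HasWeakGradient Ω U (u + v) (g + h) := by
  intro φ hφ hc hs k
  have hd : Continuous fun x => fderiv ℝ φ x (EuclideanSpace.single k 1) :=
    (hφ.continuous_fderiv (by simp)).clm_apply continuous_const
  have hdc : HasCompactSupport fun x => fderiv ℝ φ x (EuclideanSpace.single k 1) :=
    hc.fderiv_apply ℝ _
  have h1 : ∫ x in Ω, (u + v : L2 Ω ℝ) x * fderiv ℝ φ x (EuclideanSpace.single k 1)
      = (∫ x in Ω, u x * fderiv ℝ φ x (EuclideanSpace.single k 1))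
        + ∫ x in Ω, v x * fderiv ℝ φ x (EuclideanSpace.single k 1) := by
    rw [← integral_add (integrable_L2_mul u hd hdc) (integrable_L2_mul v hd hdc)]
    apply integral_congr_ae
    filter_upwards [Lp.coeFn_add u v] with x hx
    rw [hx, Pi.add_apply, add_mul]
  have h2 : ∫ x in Ω, (g + h : L2 Ω Plane) x k * φ x
      = (∫ x in Ω, g x k * φ x) + ∫ x in Ω, h x k * φ x := by
    rw [← integral_add (integrable_L2_coord_mul g k hφ.continuous hc)
      (integrable_L2_coord_mul h k hφ.continuous hc)]
    apply integral_congr_ae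
    filter_upwards [Lp.coeFn_add g h] with x hx
    rw [hx, Pi.add_apply, PiLp.add_apply, add_mul]
  rw [h1, h2, hu φ hφ hc hs k, hv φ hφ hc hs k]
  ring

theorem HasWeakGradient.smul {Ω U : Set Plane} {u : L2 Ω ℝ} {g : L2 Ω Plane} (r : ℝ)
    (hu : HasWeakGradient Ω U u g) : HasWeakGradient Ω U (r • u) (r • g) := by
  intro φ hφ hc hs k
  have h1 : ∫ x in Ω, (r • u : L2 Ω ℝ) x * fderiv ℝ φ x (EuclideanSpace.single k 1)
      = r * ∫ x in Ω, u x * fderiv ℝ φ x (EuclideanSpace.single k 1) := by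
    rw [← integral_const_mul]
    apply integral_congr_ae
    filter_upwards [Lp.coeFn_smul r u] with x hx
    rw [hx, Pi.smul_apply, smul_eq_mul, mul_assoc]
  have h2 : ∫ x in Ω, (r • g : L2 Ω Plane) x k * φ x = r * ∫ x in Ω, g x k * φ x := by
    rw [← integral_const_mul]
    apply integral_congr_ae
    filter_upwards [Lp.coeFn_smul r g] with x hx
    rw [hx, Pi.smul_apply, PiLp.smul_apply, smul_eq_mul, mul_assoc]
  rw [h1, h2, hu φ hφ hc hs k]
  ring

theorem HasWeakCurl.zero (Ω : Set Plane) : HasWeakCurl Ω 0 0 := by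
  refine ⟨0, HasWeakGradient.zero Ω Ω, ?_⟩
  filter_upwards [Lp.coeFn_zero Plane 2 (volume.restrict Ω)] with x hx
  rw [hx]
  ext k
  fin_cases k <;> simp

theorem HasWeakCurl.add {Ω : Set Plane} {β β' : L2 Ω ℝ} {c c' : L2 Ω Plane}
    (h : HasWeakCurl Ω β c) (h' : HasWeakCurl Ω β' c') : HasWeakCurl Ω (β + β') (c + c') := by
  obtain ⟨g, hg, hc⟩ := h
  obtain ⟨g', hg', hc'⟩ := h'
  refine ⟨g + g', hg.add hg', ?_⟩
  filter_upwards [hc, hc', Lp.coeFn_add c c', Lp.coeFn_add g g'] with x h1 h2 h3 h4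
  rw [h3, h4, Pi.add_apply, Pi.add_apply, h1, h2]
  ext k
  fin_cases k <;> simp [add_comm]

theorem HasWeakCurl.smul {Ω : Set Plane} {β : L2 Ω ℝ} {c : L2 Ω Plane} (r : ℝ)
    (h : HasWeakCurl Ω β c) : HasWeakCurl Ω (r • β) (r • c) := by
  obtain ⟨g, hg, hc⟩ := h
  refine ⟨r • g, hg.smul r, ?_⟩
  filter_upwards [hc, Lp.coeFn_smul r c, Lp.coeFn_smul r g] with x h1 h3 h4
  rw [h3, h4, Pi.smul_apply, Pi.smul_apply, h1]
  ext k
  fin_cases k <;> simp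

/-- `Y = H¹(Ω) ∩ L²₀(Ω)`: square integrable functions with square integrable weak gradient and
vanishing integral. -/
noncomputable def spaceY (Ω : Set Plane) : Submodule ℝ (L2 Ω ℝ) where
  carrier := {β | (∃ g, HasWeakGradient Ω Ω β g) ∧ Integrable β (volume.restrict Ω) ∧
    ∫ x in Ω, β x = 0}
  zero_mem' := by
    refine ⟨⟨0, HasWeakGradient.zero Ω Ω⟩, ?_, ?_⟩
    · exact (integrable_zero _ _ _).congr (Lp.coeFn_zero ℝ 2 (volume.restrict Ω)).symm
    · rw [integral_congr_ae (Lp.coeFn_zero ℝ 2 (volume.restrict Ω))]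
      simp
  add_mem' := by
    rintro u v ⟨⟨g, hg⟩, hu, hu0⟩ ⟨⟨h, hh⟩, hv, hv0⟩
    refine ⟨⟨g + h, hg.add hh⟩, (hu.add hv).congr (Lp.coeFn_add u v).symm, ?_⟩
    rw [integral_congr_ae (Lp.coeFn_add u v), integral_add' hu hv, hu0, hv0, add_zero]
  smul_mem' := by
    rintro r u ⟨⟨g, hg⟩, hu, hu0⟩
    refine ⟨⟨r • g, hg.smul r⟩, (hu.smul r).congr (Lp.coeFn_smul r u).symm, ?_⟩
    rw [integral_congr_ae (Lp.coeFn_smul r u)]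
    simp only [Pi.smul_apply]
    rw [integral_smul, hu0, smul_zero]

/-! ### Discrete spaces -/

/-- `Q_k` on the reference rectangle: the span of the products `f(x) g(y)` of polynomials of degree
at most `k`. -/
noncomputable def refQ (k : ℕ) : Submodule ℝ (Plane → ℝ) :=
  Submodule.span ℝ {v | ∃ f g : Polynomial ℝ, f.natDegree ≤ k ∧ g.natDegree ≤ k ∧
    v = fun x => f.eval (x 0) * g.eval (x 1)}

/-- `Q^rot = span {1, x, y, x² - y²}` on the reference rectangle. -/
noncomputable def refQrot : Submodule ℝ (Plane → ℝ) :=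
  Submodule.span ℝ {fun _ => 1, fun x => x 0, fun x => x 1, fun x => x 0 ^ 2 - x 1 ^ 2}

/-- `(u ∘ ψ) = q` almost everywhere on the reference rectangle, where `ψ` is the bilinear
transformation onto the cell `z` and `u` is defined up to null sets on `Ω`. -/
def PullbackEq {F : Type*} [NormedAddCommGroup F] (Ω : Set Plane) (z : Fin 4 → Plane) (u : L2 Ω F)
    (q : Plane → F) : Prop :=
  ∀ᵐ y ∂(volume : Measure Plane).restrict Ω, ∀ x ∈ refSquare, bilin z x = y → u y = q x

theorem PullbackEq.zero {F : Type*} [NormedAddCommGroup F] (Ω : Set Plane) (z : Fin 4 → Plane) :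
    PullbackEq Ω z (0 : L2 Ω F) 0 := by
  filter_upwards [Lp.coeFn_zero F 2 ((volume : Measure Plane).restrict Ω)] with y hy x _ _
  rw [hy]; rfl

theorem PullbackEq.add {F : Type*} [NormedAddCommGroup F] {Ω : Set Plane} {z : Fin 4 → Plane}
    {u v : L2 Ω F} {q r : Plane → F} (hu : PullbackEq Ω z u q) (hv : PullbackEq Ω z v r) :
    PullbackEq Ω z (u + v) (q + r) := by
  filter_upwards [hu, hv, Lp.coeFn_add u v] with y h1 h2 h3 x hx hxy
  rw [h3, Pi.add_apply, Pi.add_apply, h1 x hx hxy, h2 x hx hxy]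

theorem PullbackEq.smul {F : Type*} [NormedAddCommGroup F] [NormedSpace ℝ F] {Ω : Set Plane}
    {z : Fin 4 → Plane} {u : L2 Ω F} {q : Plane → F} (r : ℝ) (hu : PullbackEq Ω z u q) :
    PullbackEq Ω z (r • u) (r • q) := by
  filter_upwards [hu, Lp.coeFn_smul r u] with y h1 h3 x hx hxy
  rw [h3, Pi.smul_apply, Pi.smul_apply, h1 x hx hxy]

/-- The space `V_{Q,k}(𝒯)` of all `β ∈ Y` with `β ∘ ψ_T ∈ Q_k` for all cells `T`. -/
noncomputable def spaceVQ {ι : Type*} (k : ℕ) (Ω : Set Plane) (z : ι → Fin 4 → Plane) :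
    Submodule ℝ (L2 Ω ℝ) where
  carrier := {β | β ∈ spaceY Ω ∧ ∀ i, ∃ q ∈ refQ k, PullbackEq Ω (z i) β q}
  zero_mem' := ⟨zero_mem _, fun i => ⟨0, zero_mem _, PullbackEq.zero Ω (z i)⟩⟩
  add_mem' := by
    rintro u v ⟨hu, hu'⟩ ⟨hv, hv'⟩
    refine ⟨add_mem hu hv, fun i => ?_⟩
    obtain ⟨q, hq, h⟩ := hu' i
    obtain ⟨r, hr, h'⟩ := hv' i
    exact ⟨q + r, add_mem hq hr, h.add h'⟩
  smul_mem' := by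
    rintro r u ⟨hu, hu'⟩
    refine ⟨Submodule.smul_mem _ r hu, fun i => ?_⟩
    obtain ⟨q, hq, h⟩ := hu' i
    exact ⟨r • q, Submodule.smul_mem _ r hq, h.smul r⟩

/-- `Curl V_{Q,k}(𝒯)`. -/
noncomputable def curlVQ {ι : Type*} (k : ℕ) (Ω : Set Plane) (z : ι → Fin 4 → Plane) :
    Submodule ℝ (L2 Ω Plane) where
  carrier := {c | ∃ β ∈ spaceVQ k Ω z, HasWeakCurl Ω β c}
  zero_mem' := ⟨0, zero_mem _, HasWeakCurl.zero Ω⟩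
  add_mem' := by
    rintro c c' ⟨β, hβ, h⟩ ⟨β', hβ', h'⟩
    exact ⟨β + β', add_mem hβ hβ', h.add h'⟩
  smul_mem' := by
    rintro r c ⟨β, hβ, h⟩
    exact ⟨r • β, Submodule.smul_mem _ r hβ, h.smul r⟩

/-- The local space `X_k^rect` on the reference rectangle, for `k ≥ 1`: all fields
`a (-x^k y^(k-1), x^(k-1) y^k) + (x^k b(y) + d(x,y), y^k c(x) + e(x,y))` with `a ∈ ℝ`, polynomials
`b, c` of degree at most `k - 2` (so `b = c = 0` if `k = 1`) and `d, e ∈ Q_{k-1}`. -/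
noncomputable def refX (k : ℕ) : Submodule ℝ (Plane → Plane) where
  carrier := {τ | ∃ (a : ℝ), ∃ b ∈ Polynomial.degreeLT ℝ (k - 1),
    ∃ c ∈ Polynomial.degreeLT ℝ (k - 1), ∃ d ∈ refQ (k - 1), ∃ e ∈ refQ (k - 1), ∀ x, τ x =
      a • !₂[-(x 0 ^ k * x 1 ^ (k - 1)), x 0 ^ (k - 1) * x 1 ^ k]
        + !₂[x 0 ^ k * b.eval (x 1) + d x, x 1 ^ k * c.eval (x 0) + e x]}
  zero_mem' := by
    refine ⟨0, 0, zero_mem _, 0, zero_mem _, 0, zero_mem _, 0, zero_mem _, fun x => ?_⟩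
    ext l
    fin_cases l <;> simp
  add_mem' := by
    rintro τ σ ⟨a, b, hb, c, hc, d, hd, e, he, h⟩ ⟨a', b', hb', c', hc', d', hd', e', he', h'⟩
    refine ⟨a + a', b + b', add_mem hb hb', c + c', add_mem hc hc', d + d', add_mem hd hd',
      e + e', add_mem he he', fun x => ?_⟩
    ext l
    fin_cases l <;> simp [h, h'] <;> ring
  smul_mem' := by
    rintro r τ ⟨a, b, hb, c, hc, d, hd, e, he, h⟩
    refine ⟨r * a, r • b, Submodule.smul_mem _ r hb, r • c, Submodule.smul_mem _ r hc,
      r • d, Submodule.smul_mem _ r hd, r • e, Submodule.smul_mem _ r he, fun x => ?_⟩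
    ext l
    fin_cases l <;> simp [h] <;> ring

/-- The matrix `(0, 1; -1, 0) (D(ψ⁻¹)ᵀ ∘ ψ) (0, -1; 1, 0)` for the bilinear transformation `ψ` onto
the cell `z`, where `D(ψ⁻¹) ∘ ψ = (Dψ)⁻¹`. -/
noncomputable def cellMatrix (z : Fin 4 → Plane) (x : Plane) : Matrix (Fin 2) (Fin 2) ℝ :=
  !![0, 1; -1, 0] * ((bilinJacobian z x)⁻¹).transpose * !![0, -1; 1, 0]

/-- The space `X_k^rect(𝒯)` for `k ≥ 1`. -/
noncomputable def spaceX {ι : Type*} (k : ℕ) (Ω : Set Plane) (z : ι → Fin 4 → Plane) :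
    Submodule ℝ (L2 Ω Plane) where
  carrier := {τ | ∀ i, ∃ ρ ∈ refX k,
    PullbackEq Ω (z i) τ fun x => Matrix.toEuclideanLin (cellMatrix (z i) x) (ρ x)}
  zero_mem' := fun i => by
    refine ⟨0, zero_mem _, ?_⟩
    convert PullbackEq.zero (F := Plane) Ω (z i) using 1
    funext x
    simp
  add_mem' := by
    intro τ σ h h' i
    obtain ⟨ρ, hρ, h1⟩ := h i
    obtain ⟨ρ', hρ', h2⟩ := h' i
    refine ⟨ρ + ρ', add_mem hρ hρ', ?_⟩
    convert h1.add h2 using 1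
    funext x
    simp only [Pi.add_apply, map_add]
  smul_mem' := by
    intro r τ h i
    obtain ⟨ρ, hρ, h1⟩ := h i
    refine ⟨r • ρ, Submodule.smul_mem _ r hρ, ?_⟩
    convert h1.smul r using 1
    funext x
    simp only [Pi.smul_apply, map_smul]

/-- The continuous functions `w i` represent, cell by cell, a function of the rotated nonconforming
space: `w i ∘ ψ_i ∈ Q^rot` on the reference rectangle, the integrals over an interior edge from
both sides agree, and the integrals over boundary edges vanish. -/
def IsNCFamily {ι : Type*} (Ω : Set Plane) (z : ι → Fin 4 → Plane) (w : ι → Plane → ℝ) : Prop :=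
  (∀ i, Continuous (w i) ∧ ∃ q ∈ refQrot, ∀ x ∈ refSquare, w i (bilin (z i) x) = q x) ∧
  (∀ i j p q, i ≠ j → edge (z i) p = edge (z j) q → ¬ edge (z i) p ⊆ frontier Ω →
    segmentIntegral (w i) (z i p) (z i (p + 1)) = segmentIntegral (w j) (z j q) (z j (q + 1))) ∧
  (∀ i p, edge (z i) p ⊆ frontier Ω → segmentIntegral (w i) (z i p) (z i (p + 1)) = 0)

theorem segmentIntegral_add {v w : Plane → ℝ} (hv : Continuous v) (hw : Continuous w)
    (a b : Plane) :
    segmentIntegral (v + w) a b = segmentIntegral v a b + segmentIntegral w a b := by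
  have hl : Continuous fun t : ℝ => (AffineMap.lineMap a b t : Plane) :=
    AffineMap.lineMap_continuous
  unfold segmentIntegral
  rw [← mul_add, ← intervalIntegral.integral_add]
  · rfl
  · exact (hv.comp hl).intervalIntegrable 0 1
  · exact (hw.comp hl).intervalIntegrable 0 1

theorem segmentIntegral_smul (r : ℝ) (v : Plane → ℝ) (a b : Plane) :
    segmentIntegral (r • v) a b = r * segmentIntegral v a b := by
  unfold segmentIntegral
  simp only [Pi.smul_apply, smul_eq_mul, intervalIntegral.integral_const_mul]
  ring

/-- The rotated nonconforming space `V_NC^rot(𝒯) ⊆ L²(Ω)`. The edge integrals are formed with the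
representatives that are continuous on the cells. -/
noncomputable def spaceNC {ι : Type*} (Ω : Set Plane) (z : ι → Fin 4 → Plane) :
    Submodule ℝ (L2 Ω ℝ) where
  carrier := {v | ∃ w, IsNCFamily Ω z w ∧
    ∀ i, ∀ᵐ y ∂(volume : Measure Plane).restrict Ω, y ∈ cell (z i) → v y = w i y}
  zero_mem' := by
    refine ⟨0, ⟨fun i => ⟨continuous_const, 0, zero_mem _, fun _ _ => rfl⟩, ?_, ?_⟩, fun i => ?_⟩
    · intro i j p q _ _ _
      simp [segmentIntegral]
    · intro i p _
      simp [segmentIntegral]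
    · filter_upwards [Lp.coeFn_zero ℝ 2 ((volume : Measure Plane).restrict Ω)] with y hy _
      rw [hy]; rfl
  add_mem' := by
    rintro u v ⟨w, ⟨h1, h2, h3⟩, h4⟩ ⟨w', ⟨h1', h2', h3'⟩, h4'⟩
    refine ⟨w + w', ⟨fun i => ⟨(h1 i).1.add (h1' i).1, ?_⟩, ?_, ?_⟩, fun i => ?_⟩
    · obtain ⟨q, hq, h⟩ := (h1 i).2
      obtain ⟨q', hq', h'⟩ := (h1' i).2
      refine ⟨q + q', add_mem hq hq', fun x hx => ?_⟩
      simp only [Pi.add_apply, h x hx, h' x hx]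
    · intro i j p q hij he hf
      simp only [Pi.add_apply]
      rw [segmentIntegral_add (h1 i).1 (h1' i).1, segmentIntegral_add (h1 j).1 (h1' j).1,
        h2 i j p q hij he hf, h2' i j p q hij he hf]
    · intro i p hf
      simp only [Pi.add_apply]
      rw [segmentIntegral_add (h1 i).1 (h1' i).1, h3 i p hf, h3' i p hf, add_zero]
    · filter_upwards [h4 i, h4' i, Lp.coeFn_add u v] with y e1 e2 e3 hy
      rw [e3, Pi.add_apply, e1 hy, e2 hy]; rfl
  smul_mem' := by
    rintro r u ⟨w, ⟨h1, h2, h3⟩, h4⟩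
    refine ⟨r • w, ⟨fun i => ⟨(h1 i).1.const_smul r, ?_⟩, ?_, ?_⟩, fun i => ?_⟩
    · obtain ⟨q, hq, h⟩ := (h1 i).2
      refine ⟨r • q, Submodule.smul_mem _ r hq, fun x hx => ?_⟩
      simp only [Pi.smul_apply, h x hx]
    · intro i j p q hij he hf
      simp only [Pi.smul_apply]
      rw [segmentIntegral_smul, segmentIntegral_smul, h2 i j p q hij he hf]
    · intro i p hf
      simp only [Pi.smul_apply]
      rw [segmentIntegral_smul, h3 i p hf, mul_zero]
    · filter_upwards [h4 i, Lp.coeFn_smul r u] with y e1 e3 hy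
      rw [e3, Pi.smul_apply, e1 hy]; rfl

/-- `g = ∇_NC v`: on the interior of every cell, `g` is the weak gradient of `v`. -/
def HasPiecewiseGradient {ι : Type*} (Ω : Set Plane) (z : ι → Fin 4 → Plane) (v : L2 Ω ℝ)
    (g : L2 Ω Plane) : Prop :=
  ∀ i, HasWeakGradient Ω (interior (cell (z i))) v g

/-- `∇_NC V_NC^rot(𝒯)`. -/
noncomputable def gradNC {ι : Type*} (Ω : Set Plane) (z : ι → Fin 4 → Plane) :
    Submodule ℝ (L2 Ω Plane) where
  carrier := {g | ∃ v ∈ spaceNC Ω z, HasPiecewiseGradient Ω z v g}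
  zero_mem' := ⟨0, zero_mem _, fun _ => HasWeakGradient.zero Ω _⟩
  add_mem' := by
    rintro g g' ⟨v, hv, h⟩ ⟨v', hv', h'⟩
    exact ⟨v + v', add_mem hv hv', fun i => (h i).add (h' i)⟩
  smul_mem' := by
    rintro r g ⟨v, hv, h⟩
    exact ⟨r • v, Submodule.smul_mem _ r hv, fun i => (h i).smul r⟩

/-! ### Geometry of a single square -/

/-! The bilinear map onto a square is a similarity, so both discrete spaces are described by
reference polynomials `quad α`: `α 4 = 0` gives Q_1 and `α 3 = 0` gives Q^rot. Functions in Q^rot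
are harmonic and their conjugates lie in Q_1, the conjugate of x² - y² being 2xy; hence on each
square a gradient of Q^rot is a Curl of Q_1 (`exists_turn_cellGrad_eq`). The matrix in the
definition of X_1 equals Dψ / det Dψ, which identifies X_1 with all piecewise Curls of Q_1
functions, without continuity between cells (`mem_spaceX_one_iff`). Both inclusions into X_1 follow.

Orthogonality rests on one identity on a square (`setIntegral_inner_cellGrad_turn`): the integral of
∇α · Curl β is, up to the orientation, the sum over the edges of the increment of β times the mean
of α, because Curl β is divergence free and β is affine on each edge. Summed over the cells, every
interior edge occurs twice with opposite directions. The means of α agree by definition of the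
nonconforming space, and the increments of β agree because a piecewise polynomial with a weak
gradient has no jump (`trace_eq`). The terms cancel in pairs, and boundary edges contribute nothing
(`sum_eq_zero`).

The same identity gives the converse without a dimension count. Let τ in X_1 be orthogonal to the
nonconforming gradients. Since the four edge means can be prescribed freely in Q^rot, τ can be
tested with a function whose mean is one on a single interior edge and zero on all others. This
shows that the local potentials of τ have equal increments along that edge, so on the intersection
of any two cells they differ by a constant (`increment_eq`). On a simply connected domain such
potentials fit together after adding constants, because their possible values form a covering space,
which has a global section (`exists_potential_of_isSimplyConnected`,
`exists_shift_of_increment_eq`). The glued function is continuous in Ω, hence has a weak gradient,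
and its Curl is τ (`mem_curlVQ_of_orthogonal`). As X_1 is finite-dimensional, projecting onto the
nonconforming gradients splits any field of X_1 into a gradient and a remainder of this kind. -/

theorem segment_endpoints_eq {E : Type*} [AddCommGroup E] [Module ℝ E]
    {a b c d : E} (h : segment ℝ a b = segment ℝ c d) :
    (a = c ∧ b = d) ∨ (a = d ∧ b = c) := by
  have ha : a ∈ segment ℝ c d := h ▸ left_mem_segment ℝ a b
  have hb : b ∈ segment ℝ c d := h ▸ right_mem_segment ℝ a b
  have hc : c ∈ segment ℝ a b := h ▸ left_mem_segment ℝ c d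
  have hd : d ∈ segment ℝ a b := h ▸ right_mem_segment ℝ c d
  rw [segment_eq_image'] at ha hb hc hd
  obtain ⟨s, hs, rfl⟩ := ha
  obtain ⟨t, ht, rfl⟩ := hb
  obtain ⟨u, hu, hc⟩ := hc
  obtain ⟨w, hw, hd⟩ := hd
  obtain ⟨hs0, hs1⟩ := hs
  obtain ⟨ht0, ht1⟩ := ht
  obtain ⟨hu0, hu1⟩ := hu
  obtain ⟨hw0, hw1⟩ := hw
  by_cases hcd : d - c = 0
  · simp [sub_eq_zero.1 hcd]
  have h1 : s + u * (t - s) = 0 := by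
    have : (s + u * (t - s)) • (d - c) = 0 := by
      rw [← sub_eq_zero] at hc
      rw [← hc]; module
    exact (smul_eq_zero.1 this).resolve_right hcd
  have h2 : s + w * (t - s) = 1 := by
    have : (s + w * (t - s) - 1) • (d - c) = 0 := by
      rw [← sub_eq_zero] at hd
      rw [← hd]; module
    linarith [(smul_eq_zero.1 this).resolve_right hcd]
  -- The left side of `h1` is (1 - u) s + u t, a sum of two nonnegative terms, so both vanish.
  have h3 : s * (1 - u) = 0 := by nlinarith [mul_nonneg hs0 (sub_nonneg.2 hu1), mul_nonneg hu0 ht0]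
  have h4 : u * t = 0 := by nlinarith
  rcases mul_eq_zero.1 h3 with h5 | h5
  · have : t = 1 := by subst h5; nlinarith
    left; subst h5; subst this; simp
  · have hu : u = 1 := by linarith
    have ht : t = 0 := by simpa [hu] using h4
    have : s = 1 := by subst ht; nlinarith
    right; subst ht; subst this; simp

/-- The scalar cross product in the plane. -/
def cross (v w : Plane) : ℝ := v 0 * w 1 - v 1 * w 0

/-- The squared side length of a square. -/
noncomputable def sideSq (z : Fin 4 → Plane) : ℝ := (z 1 0 - z 0 0) ^ 2 + (z 1 1 - z 0 1) ^ 2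

/-- The orientation of a square: `1` if its vertices are numbered counterclockwise, and `-1`
otherwise. -/
noncomputable def orientation (z : Fin 4 → Plane) : ℝ :=
  cross (z 1 - z 0) (z 3 - z 0) / sideSq z

/-- The inverse of the bilinear transformation onto a square. -/
noncomputable def chart (z : Fin 4 → Plane) (y : Plane) : Plane :=
  !₂[((z 1 0 - z 0 0) * (y 0 - z 0 0) + (z 1 1 - z 0 1) * (y 1 - z 0 1)) / sideSq z,
    ((z 3 0 - z 0 0) * (y 0 - z 0 0) + (z 3 1 - z 0 1) * (y 1 - z 0 1)) / sideSq z]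

theorem chart_zero (z : Fin 4 → Plane) (y : Plane) : chart z y 0 =
    ((z 1 0 - z 0 0) * (y 0 - z 0 0) + (z 1 1 - z 0 1) * (y 1 - z 0 1)) / sideSq z := rfl

theorem chart_one (z : Fin 4 → Plane) (y : Plane) : chart z y 1 =
    ((z 3 0 - z 0 0) * (y 0 - z 0 0) + (z 3 1 - z 0 1) * (y 1 - z 0 1)) / sideSq z := rfl

theorem plane_ext {x y : Plane} (h0 : x 0 = y 0) (h1 : x 1 = y 1) : x = y := by
  ext k; fin_cases k <;> assumption

theorem bilin_apply (z : Fin 4 → Plane) (x : Plane) (k : Fin 2) : bilin z x k =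
    (1 - x 0) * (1 - x 1) * z 0 k + x 0 * (1 - x 1) * z 1 k + x 0 * x 1 * z 2 k
      + (1 - x 0) * x 1 * z 3 k := by
  simp [bilin]

namespace IsSquareCell

variable {z : Fin 4 → Plane} (hz : IsSquareCell z)
include hz

theorem sideSq_pos : 0 < sideSq z := by
  unfold sideSq
  by_contra h
  have h0 : z 1 0 - z 0 0 = 0 := by nlinarith [sq_nonneg (z 1 0 - z 0 0), sq_nonneg (z 1 1 - z 0 1)]
  have h1 : z 1 1 - z 0 1 = 0 := by nlinarith [sq_nonneg (z 1 0 - z 0 0), sq_nonneg (z 1 1 - z 0 1)]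
  exact hz.1 (plane_ext (by linarith) (by linarith))

theorem two_apply (k : Fin 2) : z 2 k = z 3 k + (z 1 k - z 0 k) := by
  have := congrArg (fun v : Plane => v k) hz.2.1
  simp only [PiLp.sub_apply] at this
  linarith

theorem inner_sides :
    (z 1 0 - z 0 0) * (z 3 0 - z 0 0) + (z 1 1 - z 0 1) * (z 3 1 - z 0 1) = 0 := by
  have := hz.2.2.1
  simp only [PiLp.inner_apply, Fin.sum_univ_two, PiLp.sub_apply, RCLike.inner_apply,
    conj_trivial] at this
  linarith

theorem sideSq_eq : (z 3 0 - z 0 0) ^ 2 + (z 3 1 - z 0 1) ^ 2 = sideSq z := by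
  have := congrArg (· ^ 2) hz.2.2.2
  simp only [EuclideanSpace.norm_sq_eq, Fin.sum_univ_two, PiLp.sub_apply, Real.norm_eq_abs,
    sq_abs] at this
  exact this.symm

theorem orientation_mul_sideSq : orientation z * sideSq z =
    (z 1 0 - z 0 0) * (z 3 1 - z 0 1) - (z 1 1 - z 0 1) * (z 3 0 - z 0 0) := by
  rw [orientation, div_mul_cancel₀ _ hz.sideSq_pos.ne']
  simp [cross]

/-- Orthogonality makes `z 3 - z 0` a multiple of the quarter turn of `z 1 - z 0`, and `orientation
z` is the factor; equal side lengths then force its square to be 1. All later computations reduce to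
one side vector and a sign. -/
theorem three_zero : z 3 0 = z 0 0 - orientation z * (z 1 1 - z 0 1) := by
  have h := hz.orientation_mul_sideSq
  have h1 := hz.inner_sides
  have h2 : sideSq z * (z 3 0 - (z 0 0 - orientation z * (z 1 1 - z 0 1))) = 0 := by
    have : sideSq z * (z 3 0 - z 0 0) + (orientation z * sideSq z) * (z 1 1 - z 0 1) = 0 := by
      rw [h, sideSq]
      linear_combination (z 1 0 - z 0 0) * h1
    linear_combination this
  linarith [(mul_eq_zero.1 h2).resolve_left hz.sideSq_pos.ne']

theorem three_one : z 3 1 = z 0 1 + orientation z * (z 1 0 - z 0 0) := by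
  have h := hz.orientation_mul_sideSq
  have h1 := hz.inner_sides
  have h2 : sideSq z * (z 3 1 - (z 0 1 + orientation z * (z 1 0 - z 0 0))) = 0 := by
    have : sideSq z * (z 3 1 - z 0 1) - (orientation z * sideSq z) * (z 1 0 - z 0 0) = 0 := by
      rw [h, sideSq]
      linear_combination (z 1 1 - z 0 1) * h1
    linear_combination this
  linarith [(mul_eq_zero.1 h2).resolve_left hz.sideSq_pos.ne']

theorem orientation_sq : orientation z ^ 2 = 1 := by
  have h := hz.sideSq_eq
  rw [hz.three_zero, hz.three_one] at h
  have h2 : sideSq z * (orientation z ^ 2 - 1) = 0 := by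
    rw [sideSq] at h ⊢
    linear_combination h
  linarith [(mul_eq_zero.1 h2).resolve_left hz.sideSq_pos.ne']

theorem orientation_eq_or : orientation z = 1 ∨ orientation z = -1 := by
  have h : (orientation z - 1) * (orientation z + 1) = 0 := by
    linear_combination hz.orientation_sq
  rcases mul_eq_zero.1 h with h | h
  · left; linarith
  · right; linarith

/-- The parallelogram identity for `z 2` cancels the mixed term, so the bilinear map is affine,
indeed a similarity. -/
theorem bilin_zero (x : Plane) : bilin z x 0 =
    z 0 0 + x 0 * (z 1 0 - z 0 0) - x 1 * (orientation z * (z 1 1 - z 0 1)) := by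
  rw [bilin_apply, hz.two_apply, hz.three_zero]; ring

theorem bilin_one (x : Plane) : bilin z x 1 =
    z 0 1 + x 0 * (z 1 1 - z 0 1) + x 1 * (orientation z * (z 1 0 - z 0 0)) := by
  rw [bilin_apply, hz.two_apply, hz.three_one]; ring

theorem chart_bilin (x : Plane) : chart z (bilin z x) = x := by
  have h := hz.orientation_sq
  have hN := hz.sideSq_pos.ne'
  refine plane_ext ?_ ?_
  · rw [chart_zero, hz.bilin_zero, hz.bilin_one, div_eq_iff hN, sideSq]
    ring
  · rw [chart_one, hz.bilin_zero, hz.bilin_one, hz.three_zero, hz.three_one, div_eq_iff hN, sideSq]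
    linear_combination (x 1 * ((z 1 0 - z 0 0) ^ 2 + (z 1 1 - z 0 1) ^ 2)) * h

theorem bilin_chart (y : Plane) : bilin z (chart z y) = y := by
  have h := hz.orientation_sq
  have hN := hz.sideSq_pos.ne'
  refine plane_ext ?_ ?_
  · rw [hz.bilin_zero, chart_zero, chart_one, hz.three_zero, hz.three_one]
    field_simp
    rw [sideSq]
    linear_combination ((z 1 1 - z 0 1) * ((z 1 1 - z 0 1) * (y 0 - z 0 0) - (z 1 0 - z 0 0) * (y 1 - z 0 1))) * h
  · rw [hz.bilin_one, chart_zero, chart_one, hz.three_zero, hz.three_one]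
    field_simp
    rw [sideSq]
    linear_combination ((z 1 0 - z 0 0) * ((z 1 0 - z 0 0) * (y 1 - z 0 1) - (z 1 1 - z 0 1) * (y 0 - z 0 0))) * h

end IsSquareCell

/-! ### Topology and measure of the cells -/

theorem plane_continuous_apply (k : Fin 2) : Continuous fun y : Plane => y k :=
  (EuclideanSpace.proj (𝕜 := ℝ) k : Plane →L[ℝ] ℝ).continuous

theorem continuous_plane_mk {X : Type*} [TopologicalSpace X] {f g : X → ℝ} (hf : Continuous f)
    (hg : Continuous g) : Continuous fun x => (!₂[f x, g x] : Plane) := by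
  refine (PiLp.continuous_toLp 2 _).comp (continuous_pi fun k => ?_)
  fin_cases k
  · exact hf
  · exact hg

theorem continuous_chart (z : Fin 4 → Plane) : Continuous (chart z) := by
  have h0 := plane_continuous_apply 0
  have h1 := plane_continuous_apply 1
  exact continuous_plane_mk (by fun_prop) (by fun_prop)

theorem continuous_bilin (z : Fin 4 → Plane) : Continuous (bilin z) := by
  have h0 := plane_continuous_apply 0
  have h1 := plane_continuous_apply 1
  unfold bilin
  fun_prop

theorem isCompact_refSquare : IsCompact refSquare := by
  have : refSquare = (EuclideanSpace.equiv (Fin 2) ℝ).toHomeomorph ⁻¹'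
      (Set.univ.pi fun _ => Icc (0 : ℝ) 1) := by
    ext x
    rw [mem_preimage, mem_univ_pi]
    rfl
  rw [this, Homeomorph.isCompact_preimage]
  exact isCompact_univ_pi fun _ => isCompact_Icc

theorem convex_refSquare : Convex ℝ refSquare := by
  have : refSquare = ⋂ k : Fin 2, (EuclideanSpace.proj (𝕜 := ℝ) k : Plane →L[ℝ] ℝ) ⁻¹' Icc 0 1 := by
    ext x; simp [refSquare]
  rw [this]
  exact convex_iInter fun k => (convex_Icc 0 1).linear_preimage
    (EuclideanSpace.proj (𝕜 := ℝ) k : Plane →L[ℝ] ℝ).toLinearMap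

theorem interior_refSquare : interior refSquare = {x : Plane | ∀ k, x k ∈ Ioo (0 : ℝ) 1} := by
  refine Subset.antisymm (fun x hx k => ?_) (interior_maximal ?_ ?_)
  · have hopen : IsOpenMap fun y : Plane => y k :=
      (EuclideanSpace.proj (𝕜 := ℝ) k : Plane →L[ℝ] ℝ).isOpenMap (fun t =>
        ⟨EuclideanSpace.single k t, by simp⟩)
    have : (fun y : Plane => y k) '' interior refSquare ⊆ interior (Icc (0 : ℝ) 1) := by
      refine interior_maximal ?_ (hopen _ isOpen_interior)
      rintro _ ⟨y, hy, rfl⟩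
      exact interior_subset hy k
    rw [interior_Icc] at this
    exact this ⟨x, hx, rfl⟩
  · intro x hx k
    exact Ioo_subset_Icc_self (hx k)
  · simp only [Set.ofPred_forall]
    exact isOpen_iInter_of_finite fun k => isOpen_Ioo.preimage (plane_continuous_apply k)

theorem isClosed_edge (z : Fin 4 → Plane) (p : Fin 4) : IsClosed (edge z p) := by
  rw [edge, segment_eq_image_lineMap]
  exact (isCompact_Icc.image AffineMap.lineMap_continuous).isClosed

theorem isCompact_cell (z : Fin 4 → Plane) : IsCompact (cell z) :=
  isCompact_refSquare.image (continuous_bilin z)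

namespace IsSquareCell

variable {z : Fin 4 → Plane} (hz : IsSquareCell z)
include hz

theorem mem_cell_iff {y : Plane} : y ∈ cell z ↔ chart z y ∈ refSquare := by
  constructor
  · rintro ⟨x, hx, rfl⟩
    rwa [hz.chart_bilin]
  · intro h
    exact ⟨_, h, hz.bilin_chart y⟩

theorem cell_eq_preimage : cell z = chart z ⁻¹' refSquare := by
  ext y; exact hz.mem_cell_iff

theorem mem_interior_cell_iff {y : Plane} :
    y ∈ interior (cell z) ↔ ∀ k, chart z y k ∈ Ioo (0 : ℝ) 1 := by
  let e : Plane ≃ₜ Plane :=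
    { toFun := chart z
      invFun := bilin z
      left_inv := hz.bilin_chart
      right_inv := hz.chart_bilin
      continuous_toFun := continuous_chart z
      continuous_invFun := continuous_bilin z }
  have h : interior (cell z) = e ⁻¹' interior refSquare := by
    rw [e.preimage_interior, hz.cell_eq_preimage]; rfl
  rw [h, interior_refSquare]
  rfl

theorem convex_cell : Convex ℝ (cell z) := by
  rw [hz.cell_eq_preimage]
  intro x hx y hy a b ha hb hab
  have : chart z (a • x + b • y) = a • chart z x + b • chart z y := by
    refine plane_ext ?_ ?_ <;>
    · simp only [chart_zero, chart_one, PiLp.add_apply, PiLp.smul_apply, smul_eq_mul]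
      have := hz.sideSq_pos.ne'
      field_simp
      obtain rfl : a = 1 - b := by linarith
      ring
  rw [mem_preimage, this]
  exact convex_refSquare hx hy ha hb hab

/-- Closed convex sets have null boundary; therefore edges are invisible to integrals and almost
everywhere statements. -/
theorem volume_cell_diff_interior : volume (cell z \ interior (cell z)) = 0 := by
  rw [← (isCompact_cell z).isClosed.frontier_eq]
  exact hz.convex_cell.addHaar_frontier volume

theorem interior_cell_ae_eq : interior (cell z) =ᵐ[volume] cell z := by
  refine Filter.EventuallyLE.antisymm interior_subset.eventuallyLE ?_
  rw [ae_le_set]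
  exact hz.volume_cell_diff_interior

theorem closure_interior_cell : closure (interior (cell z)) = cell z := by
  have hne : (interior (cell z)).Nonempty := by
    refine ⟨bilin z !₂[1/2, 1/2], hz.mem_interior_cell_iff.2 fun k => ?_⟩
    rw [hz.chart_bilin]
    fin_cases k <;> norm_num
  rw [hz.convex_cell.closure_interior_eq_closure_of_nonempty_interior hne,
    (isCompact_cell z).isClosed.closure_eq]

end IsSquareCell

/-- The square with its vertices renumbered cyclically. -/
def shift (z : Fin 4 → Plane) (p : Fin 4) : Fin 4 → Plane := fun r => z (p + r)

theorem edge_shift (z : Fin 4 → Plane) (p r : Fin 4) : edge (shift z p) r = edge z (p + r) := by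
  simp only [edge, shift, add_assoc]

theorem shift_shift (z : Fin 4 → Plane) (p r : Fin 4) : shift (shift z p) r = shift z (p + r) := by
  funext s; simp [shift, add_assoc]

/-- Renumbering by one step amounts to precomposing with a quarter turn of the reference square onto
itself. -/
theorem cell_shift_one (z : Fin 4 → Plane) : cell (shift z 1) = cell z := by
  have h : ∀ x : Plane, bilin (shift z 1) x = bilin z !₂[1 - x 1, x 0] := by
    intro x
    ext k
    simp only [bilin_apply, shift]
    have e1 : (1 : Fin 4) + 0 = 1 := rfl
    have e2 : (1 : Fin 4) + 1 = 2 := rfl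
    have e3 : (1 : Fin 4) + 2 = 3 := rfl
    have e4 : (1 : Fin 4) + 3 = 0 := rfl
    simp [e2, e3, e4]
    ring
  ext y
  constructor
  · rintro ⟨x, hx, rfl⟩
    refine ⟨_, fun k => ?_, (h x).symm⟩
    have h0 := hx 0
    have h1 := hx 1
    simp only [mem_Icc] at h0 h1
    fin_cases k
    · simp [h1.1, h1.2]
    · simp [h0.1, h0.2]
  · rintro ⟨x, hx, rfl⟩
    refine ⟨!₂[x 1, 1 - x 0], fun k => ?_, ?_⟩
    · have h0 := hx 0
      have h1 := hx 1
      simp only [mem_Icc] at h0 h1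
      fin_cases k
      · simp [h1.1, h1.2]
      · simp [h0.1, h0.2]
    · rw [h]
      congr 1
      refine plane_ext ?_ ?_ <;> simp

/-- Serves to reduce claims about the edge `p` to the edge `0`. -/
theorem shift_induction {P : (Fin 4 → Plane) → Prop} (h : ∀ z, P z → P (shift z 1))
    {z : Fin 4 → Plane} (hz : P z) (p : Fin 4) : P (shift z p) := by
  have h0 : shift z 0 = z := by funext r; simp [shift]
  have h1 := h z hz
  have h2 := h _ h1
  have h3 := h _ h2
  rw [shift_shift] at h2
  rw [shift_shift, shift_shift] at h3
  fin_cases p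
  · change P (shift z 0)
    rw [h0]
    exact hz
  · exact h1
  · exact h2
  · exact h3

theorem cell_shift (z : Fin 4 → Plane) (p : Fin 4) : cell (shift z p) = cell z :=
  shift_induction (P := fun z' => cell z' = cell z) (fun z' h => (cell_shift_one z').trans h) rfl p

/-- With first side a and last side εJa, J the quarter turn, the renumbered square has first side
εJa and last side -a: the same length and the same determinant. -/
theorem IsSquareCell.shift_one_and_orientation {z : Fin 4 → Plane} (hz : IsSquareCell z) :
    IsSquareCell (shift z 1) ∧ orientation (shift z 1) = orientation z := by
  have ho := hz.orientation_sq
  have hN := hz.sideSq_pos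
  have e0 : shift z 1 0 = z 1 := rfl
  have e1 : shift z 1 1 = z 2 := rfl
  have e2 : shift z 1 2 = z 3 := rfl
  have e3 : shift z 1 3 = z 0 := rfl
  have h20 := hz.two_apply 0
  have h21 := hz.two_apply 1
  rw [hz.three_zero] at h20
  rw [hz.three_one] at h21
  have hsq : sideSq (shift z 1) = sideSq z := by
    simp only [sideSq, e0, e1, h20, h21]
    linear_combination ((z 1 0 - z 0 0) ^ 2 + (z 1 1 - z 0 1) ^ 2) * ho
  refine ⟨⟨?_, ?_, ?_, ?_⟩, ?_⟩
  · rw [e0, e1]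
    intro h
    have h0 := congrArg (fun v : Plane => v 0) h
    have h1 := congrArg (fun v : Plane => v 1) h
    simp only [h20, h21] at h0 h1
    have : sideSq z = 0 := by
      rw [sideSq]
      have a0 : orientation z * (z 1 1 - z 0 1) = 0 := by linarith
      have a1 : orientation z * (z 1 0 - z 0 0) = 0 := by linarith
      have hone : orientation z ≠ 0 := by intro h; rw [h] at ho; norm_num at ho
      rw [(mul_eq_zero.1 a0).resolve_left hone, (mul_eq_zero.1 a1).resolve_left hone]
      ring
    exact hN.ne' this
  · rw [e0, e1, e2, e3]
    refine plane_ext ?_ ?_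
    · simp only [PiLp.sub_apply, h20, hz.three_zero]
      ring
    · simp only [PiLp.sub_apply, h21, hz.three_one]
      ring
  · rw [e0, e1, e3]
    simp only [PiLp.inner_apply, Fin.sum_univ_two, PiLp.sub_apply, RCLike.inner_apply,
      conj_trivial, h20, h21]
    ring
  · rw [e0, e1, e3, ← sq_eq_sq₀ (norm_nonneg _) (norm_nonneg _)]
    simp only [EuclideanSpace.norm_sq_eq, Fin.sum_univ_two, PiLp.sub_apply, Real.norm_eq_abs,
      sq_abs, h20, h21]
    linear_combination ((z 1 0 - z 0 0) ^ 2 + (z 1 1 - z 0 1) ^ 2) * ho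
  · have : orientation (shift z 1) * sideSq z = orientation z * sideSq z := by
      rw [orientation, hsq, div_mul_cancel₀ _ hN.ne', sideSq]
      simp only [cross, e0, e1, e3, PiLp.sub_apply, h20, h21]
      ring
    exact mul_right_cancel₀ hN.ne' this

theorem IsSquareCell.shift {z : Fin 4 → Plane} (hz : IsSquareCell z) (p : Fin 4) :
    IsSquareCell (shift z p) :=
  shift_induction (fun _ h => h.shift_one_and_orientation.1) hz p

theorem IsSquareCell.orientation_shift {z : Fin 4 → Plane} (hz : IsSquareCell z) (p : Fin 4) :
    orientation (_root_.shift z p) = orientation z :=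
  (shift_induction (P := fun z' => IsSquareCell z' ∧ orientation z' = orientation z)
    (fun _ h => ⟨h.1.shift_one_and_orientation.1, h.1.shift_one_and_orientation.2.trans h.2⟩)
    ⟨hz, rfl⟩ p).2

/-! ### Vertices and edges of a square, and pairs of squares with a common edge -/

theorem lineMap_apply_coord (a b : Plane) (t : ℝ) (k : Fin 2) :
    (AffineMap.lineMap a b t : Plane) k = a k + t * (b k - a k) := by
  rw [AffineMap.lineMap_apply_module']
  simp [add_comm]

/-- The vertices of the reference square. -/
noncomputable def corner : Fin 4 → Plane := ![!₂[0, 0], !₂[1, 0], !₂[1, 1], !₂[0, 1]]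

theorem bilin_corner (z : Fin 4 → Plane) (p : Fin 4) : bilin z (corner p) = z p := by
  ext k
  rw [bilin_apply]
  fin_cases p <;> simp [corner]

theorem corner_mem_refSquare (p : Fin 4) : corner p ∈ refSquare := by
  intro k
  fin_cases p <;> fin_cases k <;> simp [corner]

theorem vertex_mem_cell (z : Fin 4 → Plane) (p : Fin 4) : z p ∈ cell z :=
  ⟨corner p, corner_mem_refSquare p, bilin_corner z p⟩

theorem openSegment_subset_edge (z : Fin 4 → Plane) (p : Fin 4) :
    openSegment ℝ (z p) (z (p + 1)) ⊆ edge z p := openSegment_subset_segment ℝ _ _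

theorem lineMap_half_mem_openSegment (a b : Plane) :
    (AffineMap.lineMap a b (1 / 2 : ℝ) : Plane) ∈ openSegment ℝ a b := by
  rw [openSegment_eq_image_lineMap]
  exact ⟨1 / 2, by norm_num, rfl⟩

namespace IsSquareCell

variable {z : Fin 4 → Plane} (hz : IsSquareCell z)
include hz

theorem chart_vertex (p : Fin 4) : chart z (z p) = corner p := by
  conv_lhs => rw [← bilin_corner z p]
  exact hz.chart_bilin _

theorem chart_lineMap (a b : Plane) (t : ℝ) :
    chart z (AffineMap.lineMap a b t) = AffineMap.lineMap (chart z a) (chart z b) t := by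
  have := hz.sideSq_pos.ne'
  refine plane_ext ?_ ?_ <;>
  · simp only [lineMap_apply_coord, chart_zero, chart_one]
    field_simp
    ring

theorem edge_subset_cell (p : Fin 4) : edge z p ⊆ cell z :=
  hz.convex_cell.segment_subset (vertex_mem_cell z p) (vertex_mem_cell z _)

/-- The chart is affine and sends vertices to corners, so only the sixteen pairs of edges of the
reference square need checking. -/
theorem eq_of_mem_openSegment_of_mem_edge {p q : Fin 4} {y : Plane}
    (hp : y ∈ openSegment ℝ (z p) (z (p + 1))) (hq : y ∈ edge z q) : p = q := by
  rw [openSegment_eq_image_lineMap] at hp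
  rw [edge, segment_eq_image_lineMap] at hq
  obtain ⟨s, ⟨hs0, hs1⟩, rfl⟩ := hp
  obtain ⟨t, ⟨ht0, ht1⟩, h⟩ := hq
  have h2 := congrArg (chart z) h
  rw [hz.chart_lineMap, hz.chart_lineMap] at h2
  simp only [hz.chart_vertex] at h2
  have h3 := congrArg (fun v : Plane => v 0) h2
  have h4 := congrArg (fun v : Plane => v 1) h2
  simp only [lineMap_apply_coord] at h3 h4
  have e1 : (3 : Fin 4) + 1 = 0 := rfl
  have e2 : (2 : Fin 4) + 1 = 3 := rfl
  have e3 : (1 : Fin 4) + 1 = 2 := rfl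
  fin_cases p <;> fin_cases q <;> first | rfl | (
    exfalso
    simp [corner, e1, e2, e3] at h3 h4
    try linarith)

theorem edge_disjoint_interior {p : Fin 4} {y : Plane} (hy : y ∈ edge z p) :
    y ∉ interior (cell z) := by
  rw [hz.mem_interior_cell_iff]
  intro h
  have h0 := h 0
  have h1 := h 1
  rw [edge, segment_eq_image_lineMap] at hy
  obtain ⟨t, ⟨ht0, ht1⟩, rfl⟩ := hy
  rw [hz.chart_lineMap, hz.chart_vertex, hz.chart_vertex] at h0 h1
  simp only [lineMap_apply_coord] at h0 h1
  have e1 : (3 : Fin 4) + 1 = 0 := rfl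
  have e2 : (2 : Fin 4) + 1 = 3 := rfl
  have e3 : (1 : Fin 4) + 1 = 2 := rfl
  fin_cases p <;> simp [corner, e1, e2, e3] at h0 h1

/-- The vertex `z q` lies on the two different edges `q` and `q - 1`, while an inner point of an
edge lies on one edge only. -/
theorem vertex_notMem_openSegment (p q : Fin 4) : z q ∉ openSegment ℝ (z p) (z (p + 1)) := by
  intro h
  have h1 := hz.eq_of_mem_openSegment_of_mem_edge h (left_mem_segment ℝ (z q) (z (q + 1)))
  have h2 : p = q - 1 := hz.eq_of_mem_openSegment_of_mem_edge h (by
    have := right_mem_segment ℝ (z (q - 1)) (z (q - 1 + 1))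
    rw [sub_add_cancel] at this
    rw [edge, sub_add_cancel]
    exact this)
  have h3 : ∀ r : Fin 4, r ≠ r - 1 := by decide
  exact h3 q (h1 ▸ h2)

theorem edge_injective {p q : Fin 4} (h : edge z p = edge z q) : p = q :=
  hz.eq_of_mem_openSegment_of_mem_edge (lineMap_half_mem_openSegment _ _)
    (h ▸ openSegment_subset_edge z p (lineMap_half_mem_openSegment _ _))

theorem center_notMem_edge (p : Fin 4) : bilin z !₂[1 / 2, 1 / 2] ∉ edge z p := by
  intro h
  refine hz.edge_disjoint_interior h (hz.mem_interior_cell_iff.2 fun k => ?_)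
  rw [hz.chart_bilin]
  fin_cases k <;> norm_num

/-- Two squares that meet only in a common edge lie on different sides of that edge. -/
theorem opposite_zero {z' : Fin 4 → Plane} (hz' : IsSquareCell z')
    (he : edge z 0 = edge z' 0) (hc : cell z ∩ cell z' ⊆ edge z 0) :
    (z' 0 = z 0 ∧ z' 1 = z 1 ∧ orientation z' = -orientation z) ∨
      (z' 0 = z 1 ∧ z' 1 = z 0 ∧ orientation z' = orientation z) := by
  -- Squares on the same side of a common edge would coincide. Their centres detect this whatever
  -- the numbering, and a centre in both cells would have to lie on the edge.
  have key : bilin z !₂[1 / 2, 1 / 2] ≠ bilin z' !₂[1 / 2, 1 / 2] := by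
    intro h
    have hm : (!₂[1 / 2, 1 / 2] : Plane) ∈ refSquare := by
      intro k; fin_cases k <;> norm_num
    exact hz.center_notMem_edge 0 (hc ⟨⟨_, hm, rfl⟩, ⟨_, hm, h.symm⟩⟩)
  have ho := hz.orientation_eq_or
  have ho' := hz'.orientation_eq_or
  rcases segment_endpoints_eq he with ⟨h0, h1⟩ | ⟨h0, h1⟩
  · left
    refine ⟨h0.symm, h1.symm, ?_⟩
    change z 1 = z' 1 at h1
    by_contra hne
    refine key ?_
    have : orientation z' = orientation z := by
      rcases ho with h | h <;> rcases ho' with h' | h' <;> rw [h, h'] at hne ⊢ <;> norm_num at hne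
    refine plane_ext ?_ ?_
    · rw [hz.bilin_zero, hz'.bilin_zero, this, h0, h1]
    · rw [hz.bilin_one, hz'.bilin_one, this, h0, h1]
  · right
    change z 1 = z' 0 at h1
    refine ⟨h1.symm, h0.symm, ?_⟩
    by_contra hne
    refine key ?_
    have : orientation z' = -orientation z := by
      rcases ho with h | h <;> rcases ho' with h' | h' <;> rw [h, h'] at hne ⊢ <;> norm_num at *
    change z 0 = z' 1 at h0
    refine plane_ext ?_ ?_
    · rw [hz.bilin_zero, hz'.bilin_zero, this, h0, h1]
      simp only [Matrix.cons_val_zero, Matrix.cons_val_one]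
      ring
    · rw [hz.bilin_one, hz'.bilin_one, this, h0, h1]
      simp only [Matrix.cons_val_zero, Matrix.cons_val_one]
      ring

theorem opposite {z' : Fin 4 → Plane} (hz' : IsSquareCell z') {p q : Fin 4}
    (he : edge z p = edge z' q) (hc : cell z ∩ cell z' ⊆ edge z p) :
    (z' q = z p ∧ z' (q + 1) = z (p + 1) ∧ orientation z' = -orientation z) ∨
      (z' q = z (p + 1) ∧ z' (q + 1) = z p ∧ orientation z' = orientation z) := by
  have h := (hz.shift p).opposite_zero (hz'.shift q)
    (by rw [edge_shift, edge_shift, add_zero, add_zero, he])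
    (by rw [edge_shift, cell_shift, cell_shift, add_zero]; exact hc)
  rw [hz.orientation_shift, hz'.orientation_shift] at h
  simpa only [_root_.shift, add_zero] using h

/-- The second chart is the first one reflected in the edge: its second coordinate changes sign, and
its first is kept or replaced by its complement to 1. Hence the open rectangle (0,1) × (-1,1) of the
first chart is covered by the two cells. -/
theorem mem_interior_union_zero {z' : Fin 4 → Plane} (hz' : IsSquareCell z')
    (he : edge z 0 = edge z' 0) (hc : cell z ∩ cell z' ⊆ edge z 0) {y : Plane}
    (hy : y ∈ openSegment ℝ (z 0) (z 1)) : y ∈ interior (cell z ∪ cell z') := by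
  have hch : ∀ w, chart z' w 1 = - chart z w 1 ∧
      (chart z' w 0 = chart z w 0 ∨ chart z' w 0 = 1 - chart z w 0) := by
    intro w
    have hN := hz.sideSq_pos.ne'
    have ho := hz.orientation_sq
    rcases hz.opposite_zero hz' he hc with ⟨h0, h1, h2⟩ | ⟨h0, h1, h2⟩
    · have hN' : sideSq z' = sideSq z := by rw [sideSq, sideSq, h0, h1]
      refine ⟨?_, Or.inl ?_⟩
      · rw [chart_one, chart_one, hN', hz.three_zero, hz.three_one, hz'.three_zero, hz'.three_one,
          h0, h1, h2]
        ring
      · rw [chart_zero, chart_zero, hN', h0, h1]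
    · have hN' : sideSq z' = sideSq z := by rw [sideSq, sideSq, h0, h1]; ring
      refine ⟨?_, Or.inr ?_⟩
      · rw [chart_one, chart_one, hN', hz.three_zero, hz.three_one, hz'.three_zero, hz'.three_one,
          h0, h1, h2]
        ring
      · rw [chart_zero, chart_zero, hN', h0, h1, eq_sub_iff_add_eq, ← add_div,
          div_eq_one_iff_eq hN, sideSq]
        ring
  have hopen : IsOpen {w : Plane | chart z w 0 ∈ Ioo (0 : ℝ) 1 ∧ chart z w 1 ∈ Ioo (-1 : ℝ) 1} :=
    (isOpen_Ioo.preimage ((plane_continuous_apply 0).comp (continuous_chart z))).inter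
      (isOpen_Ioo.preimage ((plane_continuous_apply 1).comp (continuous_chart z)))
  refine interior_maximal ?_ hopen ?_
  · rintro w ⟨⟨h0, h0'⟩, ⟨h1, h1'⟩⟩
    obtain ⟨e1, e0⟩ := hch w
    rcases le_total 0 (chart z w 1) with h | h
    · left
      rw [hz.mem_cell_iff]
      intro k
      fin_cases k
      · exact ⟨h0.le, h0'.le⟩
      · exact ⟨h, h1'.le⟩
    · right
      rw [hz'.mem_cell_iff]
      intro k
      fin_cases k
      · change chart z' w 0 ∈ _
        rcases e0 with e0 | e0 <;> rw [e0] <;> constructor <;> linarith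
      · change chart z' w 1 ∈ _
        rw [e1]; constructor <;> linarith
  · rw [openSegment_eq_image_lineMap] at hy
    obtain ⟨t, ht, rfl⟩ := hy
    have h0 : (0 : Fin 4) + 1 = 1 := rfl
    simp only [Set.mem_ofPred_eq, hz.chart_lineMap, hz.chart_vertex, lineMap_apply_coord]
    simpa [corner] using ht

theorem mem_interior_union {z' : Fin 4 → Plane} (hz' : IsSquareCell z') {p q : Fin 4}
    (he : edge z p = edge z' q) (hc : cell z ∩ cell z' ⊆ edge z p) {y : Plane}
    (hy : y ∈ openSegment ℝ (z p) (z (p + 1))) : y ∈ interior (cell z ∪ cell z') := by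
  have h := (hz.shift p).mem_interior_union_zero (hz'.shift q)
    (by rw [edge_shift, edge_shift, add_zero, add_zero, he])
    (by rw [edge_shift, cell_shift, cell_shift, add_zero]; exact hc) (y := y)
    (by simpa only [_root_.shift, add_zero] using hy)
  rwa [cell_shift, cell_shift] at h

end IsSquareCell

/-! ### Square partitions -/

/-- Moving from a boundary point slightly in the graph direction leads to points strictly above the
graph, which have neighbourhoods free of Ω. So the domain has no slits; this is what the Lipschitz
boundary contributes. -/
theorem HasLipschitzBoundary.interior_closure {Ω : Set Plane} (h : HasLipschitzBoundary Ω)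
    (hO : IsOpen Ω) : interior (closure Ω) = Ω := by
  refine Subset.antisymm (fun x hx => ?_) (interior_maximal subset_closure hO)
  by_contra hxΩ
  have hxf : x ∈ frontier Ω := by
    rw [hO.frontier_eq]
    exact ⟨interior_subset hx, hxΩ⟩
  obtain ⟨R, γ, K, δ, hγ, hδ, hy⟩ := h x hxf
  set e : Plane := R.symm (EuclideanSpace.single 1 1) with he
  have hRe : R e = EuclideanSpace.single 1 1 := R.apply_symm_apply _
  have hx1 : γ ((R x) 0) ≤ (R x) 1 := not_lt.1 fun hlt => hxΩ ((hy x (Metric.mem_ball_self hδ)).2 hlt)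
  have hcont : Continuous fun t : ℝ => x + t • e := by fun_prop
  have hev : ∀ᶠ t : ℝ in nhds 0, x + t • e ∈ interior (closure Ω) ∩ Metric.ball x δ := by
    refine hcont.continuousAt.eventually ?_
    simp only [zero_smul, add_zero]
    exact (isOpen_interior.inter Metric.isOpen_ball).mem_nhds ⟨hx, Metric.mem_ball_self hδ⟩
  obtain ⟨t, ht, ht0⟩ := ((hev.filter_mono nhdsWithin_le_nhds).and
    (self_mem_nhdsWithin (a := (0 : ℝ)) (s := Ioi 0))).exists
  have ht0 : 0 < t := ht0
  have hopen : IsOpen {y : Plane | γ ((R y) 0) < (R y) 1} :=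
    isOpen_lt (hγ.continuous.comp ((plane_continuous_apply 0).comp R.continuous))
      ((plane_continuous_apply 1).comp R.continuous)
  have hmem : γ ((R (x + t • e)) 0) < (R (x + t • e)) 1 := by
    rw [map_add, map_smul, hRe]
    simp
    linarith
  have hcl : x + t • e ∈ closure Ω := interior_subset ht.1
  obtain ⟨y, ⟨hy1, hy2⟩, hyΩ⟩ := mem_closure_iff.1 hcl _ (hopen.inter Metric.isOpen_ball)
    ⟨hmem, ht.2⟩
  exact absurd ((hy y hy2).1 hyΩ) (not_lt.2 (le_of_lt hy1))

/-- A regular partition into squares of an open set that is the interior of its closure. -/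
structure IsSquareMesh {ι : Type*} (Ω : Set Plane) (z : ι → Fin 4 → Plane) : Prop where
  isOpen : IsOpen Ω
  interior_closure : interior (closure Ω) = Ω
  square : ∀ i, IsSquareCell (z i)
  partition : IsRegularPartition Ω z

namespace IsSquareMesh

variable {ι : Type*} {Ω : Set Plane} {z : ι → Fin 4 → Plane} (hM : IsSquareMesh Ω z)
include hM

theorem cell_subset_closure (i : ι) : cell (z i) ⊆ closure Ω := by
  rw [hM.partition.1]; exact subset_iUnion (fun i => cell (z i)) i

theorem interior_cell_subset (i : ι) : interior (cell (z i)) ⊆ Ω := by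
  conv_rhs => rw [← hM.interior_closure]
  exact interior_mono (hM.cell_subset_closure i)

theorem exists_mem_cell {y : Plane} (hy : y ∈ Ω) : ∃ i, y ∈ cell (z i) := by
  have := subset_closure hy
  rw [hM.partition.1] at this
  exact mem_iUnion.1 this

theorem disjoint_interior {i j : ι} (hij : i ≠ j) :
    Disjoint (interior (cell (z i))) (interior (cell (z j))) := by
  rw [Set.disjoint_left]
  intro y hi hj
  have hy : y ∈ cell (z i) ∩ cell (z j) := ⟨interior_subset hi, interior_subset hj⟩
  rcases hM.partition.2 i j hij with h | ⟨p, q, -, h⟩ | ⟨p, q, -, h⟩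
  · rw [h] at hy; exact hy
  · rw [h] at hy
    rw [mem_singleton_iff.1 hy] at hi
    exact (hM.square i).edge_disjoint_interior (left_mem_segment ℝ (z i p) (z i (p + 1))) hi
  · rw [h] at hy
    exact (hM.square i).edge_disjoint_interior hy hi

/-- An inner point of an edge is not a vertex, so of the three ways in which cells may meet only the
common edge remains, and it must be the edge through that point. -/
theorem exists_edge_eq {i j : ι} (hij : i ≠ j) {p : Fin 4} {y : Plane}
    (hy : y ∈ openSegment ℝ (z i p) (z i (p + 1))) (hj : y ∈ cell (z j)) :
    ∃ q, edge (z i) p = edge (z j) q ∧ cell (z i) ∩ cell (z j) = edge (z i) p := by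
  have hyi : y ∈ edge (z i) p := openSegment_subset_edge _ _ hy
  have hm : y ∈ cell (z i) ∩ cell (z j) := ⟨(hM.square i).edge_subset_cell p hyi, hj⟩
  rcases hM.partition.2 i j hij with h | ⟨r, q, -, h⟩ | ⟨r, q, he, h⟩
  · rw [h] at hm; exact hm.elim
  · rw [h] at hm
    rw [mem_singleton_iff.1 hm] at hy
    exact ((hM.square i).vertex_notMem_openSegment p r hy).elim
  · have hr : y ∈ edge (z i) r := h ▸ hm
    obtain rfl := (hM.square i).eq_of_mem_openSegment_of_mem_edge hy hr
    exact ⟨q, he, h⟩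

theorem inter_eq_edge {i j : ι} (hij : i ≠ j) {p q : Fin 4} (he : edge (z i) p = edge (z j) q) :
    cell (z i) ∩ cell (z j) = edge (z i) p := by
  have hm := lineMap_half_mem_openSegment (z i p) (z i (p + 1))
  have hj := (hM.square j).edge_subset_cell q (he ▸ openSegment_subset_edge _ _ hm)
  obtain ⟨_, -, h⟩ := hM.exists_edge_eq hij hm hj
  exact h

theorem opposite {i j : ι} (hij : i ≠ j) {p q : Fin 4} (he : edge (z i) p = edge (z j) q) :
    (z j q = z i p ∧ z j (q + 1) = z i (p + 1) ∧ orientation (z j) = -orientation (z i)) ∨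
      (z j q = z i (p + 1) ∧ z j (q + 1) = z i p ∧ orientation (z j) = orientation (z i)) :=
  (hM.square i).opposite (hM.square j) he (hM.inter_eq_edge hij he).subset

/-- `orientation z • (z (p + 1) - z p)` is the edge vector in counterclockwise direction. Squares on
different sides run through their common edge in opposite directions, however they are numbered. -/
theorem orientation_smul_tangent {i j : ι} (hij : i ≠ j) {p q : Fin 4}
    (he : edge (z i) p = edge (z j) q) :
    orientation (z j) • (z j (q + 1) - z j q) = -(orientation (z i) • (z i (p + 1) - z i p)) := by
  rcases hM.opposite hij he with ⟨h1, h2, h3⟩ | ⟨h1, h2, h3⟩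
  · rw [h1, h2, h3, neg_smul]
  · rw [h1, h2, h3, ← smul_neg, neg_sub]

/-- Three cells at one edge would have counterclockwise edge vectors that are pairwise negatives of
each other, hence zero. -/
theorem eq_of_edge_eq {i j k : ι} (hij : i ≠ j) (hik : i ≠ k) {p q r : Fin 4}
    (hj : edge (z i) p = edge (z j) q) (hk : edge (z i) p = edge (z k) r) : j = k := by
  by_contra hjk
  have h1 := hM.orientation_smul_tangent hij hj
  have h2 := hM.orientation_smul_tangent hik hk
  have h3 := hM.orientation_smul_tangent hjk (hj.symm.trans hk)
  rw [h1, h2, neg_neg] at h3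
  have h4 : orientation (z i) • (z i (p + 1) - z i p) = 0 := by
    have h5 : (2 : ℝ) • (orientation (z i) • (z i (p + 1) - z i p)) = 0 := by
      rw [two_smul]
      nth_rewrite 1 [← h3]
      exact neg_add_cancel _
    exact (smul_eq_zero.1 h5).resolve_left two_ne_zero
  rcases smul_eq_zero.1 h4 with h5 | h5
  · have := (hM.square i).orientation_sq
    rw [h5] at this
    norm_num at this
  · have h6 : z i p ∈ openSegment ℝ (z i p) (z i (p + 1)) := by
      rw [sub_eq_zero.1 h5, openSegment_same]; rfl
    exact (hM.square i).vertex_notMem_openSegment p p h6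

/-- Inner points of a shared edge are interior to the union of the two cells, and the interior of
the closure of Ω is Ω itself. -/
theorem openSegment_subset {i j : ι} (hij : i ≠ j) {p q : Fin 4}
    (he : edge (z i) p = edge (z j) q) : openSegment ℝ (z i p) (z i (p + 1)) ⊆ Ω := by
  intro y hy
  have h := (hM.square i).mem_interior_union (hM.square j) he (hM.inter_eq_edge hij he).subset hy
  rw [← hM.interior_closure]
  exact interior_mono (union_subset (hM.cell_subset_closure i) (hM.cell_subset_closure j)) h

theorem not_subset_frontier {i j : ι} (hij : i ≠ j) {p q : Fin 4}
    (he : edge (z i) p = edge (z j) q) : ¬ edge (z i) p ⊆ frontier Ω := by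
  intro h
  have hm := lineMap_half_mem_openSegment (z i p) (z i (p + 1))
  have h1 := h (openSegment_subset_edge _ _ hm)
  rw [hM.isOpen.frontier_eq] at h1
  exact h1.2 (hM.openSegment_subset hij he hm)

/-- An edge not contained in the boundary has an inner point in Ω. If no other cell contained that
point, the finitely many other closed cells would leave it a neighbourhood inside the single cell,
although it lies on an edge. -/
theorem exists_neighbor [Finite ι] {i : ι} {p : Fin 4} (h : ¬ edge (z i) p ⊆ frontier Ω) :
    ∃ j q, i ≠ j ∧ edge (z i) p = edge (z j) q := by
  obtain ⟨x, hx, hxf⟩ := not_subset.1 h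
  have hxΩ : x ∈ Ω := by
    by_contra hn
    refine hxf ?_
    rw [hM.isOpen.frontier_eq]
    exact ⟨hM.cell_subset_closure i ((hM.square i).edge_subset_cell p hx), hn⟩
  obtain ⟨y, hyΩ, hy⟩ : ∃ y ∈ Ω, y ∈ openSegment ℝ (z i p) (z i (p + 1)) := by
    have hxc : x ∈ closure (openSegment ℝ (z i p) (z i (p + 1))) :=
      segment_subset_closure_openSegment hx
    exact mem_closure_iff.1 hxc Ω hM.isOpen hxΩ
  by_contra! hno
  have hnot : ∀ j, i ≠ j → y ∉ cell (z j) := by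
    intro j hij hj
    obtain ⟨q, hq, -⟩ := hM.exists_edge_eq hij hy hj
    exact hno j q hij hq
  have hopen : IsOpen (Ω ∩ ⋂ j : {j // i ≠ j}, (cell (z j))ᶜ) :=
    hM.isOpen.inter (isOpen_iInter_of_finite fun j => (isCompact_cell (z j)).isClosed.isOpen_compl)
  have hsub : Ω ∩ ⋂ j : {j // i ≠ j}, (cell (z j))ᶜ ⊆ cell (z i) := by
    rintro w ⟨hw, hw'⟩
    obtain ⟨j, hj⟩ := hM.exists_mem_cell hw
    by_cases hij : i = j
    · exact hij ▸ hj
    · exact (mem_iInter.1 hw' ⟨j, hij⟩ hj).elim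
  refine (hM.square i).edge_disjoint_interior (openSegment_subset_edge _ _ hy)
    (interior_maximal hsub hopen ⟨hyΩ, mem_iInter.2 fun j => hnot j j.2⟩)

/-- Interior edges carry exactly two pairs (cell, edge), and exchanging them is an involution. Both
the global integration by parts and the discrete orthogonality are instances of this cancellation.
-/
theorem sum_eq_zero [Fintype ι] (H : ι → Fin 4 → ℝ)
    (hb : ∀ i p, edge (z i) p ⊆ frontier Ω → H i p = 0)
    (hc : ∀ i j p q, i ≠ j → edge (z i) p = edge (z j) q → H i p + H j q = 0) :
    ∑ i, ∑ p, H i p = 0 := by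
  classical
  rw [← Fintype.sum_prod_type']
  let P : ι × Fin 4 → ι × Fin 4 → Prop := fun a b => a.1 ≠ b.1 ∧ edge (z a.1) a.2 = edge (z b.1) b.2
  -- A pair without partner is fixed by `g`; this is harmless because its edge lies in the boundary
  -- and its term vanishes.
  let g : ι × Fin 4 → ι × Fin 4 := fun a => if h : ∃ b, P a b then h.choose else a
  have hg : ∀ a, (∃ b, P a b) → P a (g a) := by
    intro a h
    simp only [g, dif_pos h]
    exact h.choose_spec
  have hz : ∀ a, (¬ ∃ b, P a b) → H a.1 a.2 = 0 := by
    intro a h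
    by_contra hne
    obtain ⟨j, q, hij, he⟩ := hM.exists_neighbor fun hf => hne (hb a.1 a.2 hf)
    exact h ⟨(j, q), hij, he⟩
  refine Finset.sum_involution (fun a _ => g a) ?_ ?_ (fun _ _ => Finset.mem_univ _) ?_
  · intro a _
    by_cases h : ∃ b, P a b
    · exact hc _ _ _ _ (hg a h).1 (hg a h).2
    · simp only [g, dif_neg h, hz a h, add_zero]
  · intro a _ hne heq
    have h : ∃ b, P a b := by
      by_contra h
      exact hne (hz a h)
    exact (hg a h).1 (by rw [heq])
  · intro a _
    by_cases h : ∃ b, P a b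
    · have h1 := hg a h
      have h2 := hg (g a) ⟨a, h1.1.symm, h1.2.symm⟩
      have h3 : (g (g a)).1 = a.1 := hM.eq_of_edge_eq h2.1 h1.1.symm h2.2 h1.2.symm
      refine Prod.ext h3 ?_
      have h4 : edge (z (g (g a)).1) (g (g a)).2 = edge (z a.1) a.2 := h2.2.symm.trans h1.2.symm
      rw [h3] at h4
      exact (hM.square a.1).edge_injective h4
    · have : g a = a := by simp only [g, dif_neg h]
      rw [this, this]

end IsSquareMesh

/-! ### Integration over squares -/

/-- The mean of a function over the segment from `a` to `b`. -/
noncomputable def edgeMean (v : Plane → ℝ) (a b : Plane) : ℝ :=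
  ∫ t in (0 : ℝ)..1, v (AffineMap.lineMap a b t)

theorem edgeMean_comm (v : Plane → ℝ) (a b : Plane) : edgeMean v a b = edgeMean v b a := by
  unfold edgeMean
  have h := intervalIntegral.integral_comp_sub_left (a := 0) (b := 1)
    (fun t => v (AffineMap.lineMap b a t)) 1
  simpa only [sub_self, sub_zero, AffineMap.lineMap_apply_one_sub] using h

theorem edgeMean_congr {v w : Plane → ℝ} {a b : Plane} (h : ∀ y ∈ segment ℝ a b, v y = w y) :
    edgeMean v a b = edgeMean w a b := by
  refine intervalIntegral.integral_congr fun t ht => h _ ?_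
  rw [uIcc_of_le zero_le_one] at ht
  rw [segment_eq_image_lineMap]
  exact ⟨t, ht, rfl⟩

theorem edgeMean_eq_zero {v : Plane → ℝ} {a b : Plane} (h : ∀ y ∈ segment ℝ a b, v y = 0) :
    edgeMean v a b = 0 := by
  rw [edgeMean_congr h]
  simp [edgeMean]

theorem setIntegral_refSquare_eq (f : Plane → ℝ) :
    ∫ x in refSquare, f x = ∫ y in Icc (0 : ℝ) 1 ×ˢ Icc (0 : ℝ) 1, f !₂[y.1, y.2] := by
  let E : Plane ≃ᵐ ℝ × ℝ :=
    (MeasurableEquiv.toLp 2 (Fin 2 → ℝ)).symm.trans MeasurableEquiv.finTwoArrow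
  have hE : MeasurePreserving E volume volume :=
    (volume_preserving_finTwoArrow ℝ).comp
      (EuclideanSpace.volume_preserving_symm_measurableEquiv_toLp (Fin 2))
  have hset : refSquare = E ⁻¹' (Icc (0 : ℝ) 1 ×ˢ Icc (0 : ℝ) 1) := by
    ext x
    change (∀ k, x k ∈ _) ↔ x 0 ∈ _ ∧ x 1 ∈ _
    simp only [Fin.forall_fin_two]
  have hfE : f = (fun y : ℝ × ℝ => f !₂[y.1, y.2]) ∘ E := by
    funext x
    exact congrArg f (plane_ext rfl rfl)
  rw [hset]
  conv_lhs => rw [hfE]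
  exact hE.setIntegral_preimage_emb E.measurableEmbedding (fun y : ℝ × ℝ => f !₂[y.1, y.2]) _

theorem integrableOn_unitSquare {f : Plane → ℝ} (hf : Continuous f) :
    IntegrableOn (fun y : ℝ × ℝ => f !₂[y.1, y.2]) (Icc (0 : ℝ) 1 ×ˢ Icc (0 : ℝ) 1) :=
  (hf.comp (continuous_plane_mk continuous_fst continuous_snd)).continuousOn.integrableOn_compact
    (isCompact_Icc.prod isCompact_Icc)

theorem setIntegral_refSquare {f : Plane → ℝ} (hf : Continuous f) :
    ∫ x in refSquare, f x = ∫ s in (0 : ℝ)..1, ∫ t in (0 : ℝ)..1, f !₂[s, t] := by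
  have h := integrableOn_unitSquare hf
  rw [Measure.volume_eq_prod] at h
  rw [setIntegral_refSquare_eq, Measure.volume_eq_prod, setIntegral_prod _ h]
  simp only [intervalIntegral.integral_of_le zero_le_one, integral_Icc_eq_integral_Ioc]

theorem setIntegral_refSquare_swap {f : Plane → ℝ} (hf : Continuous f) :
    ∫ x in refSquare, f x = ∫ t in (0 : ℝ)..1, ∫ s in (0 : ℝ)..1, f !₂[s, t] := by
  have h := integrableOn_unitSquare hf
  rw [IntegrableOn, Measure.volume_eq_prod, ← Measure.prod_restrict] at h
  rw [setIntegral_refSquare_eq, Measure.volume_eq_prod, ← Measure.prod_restrict,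
    integral_prod_symm _ h]
  simp only [intervalIntegral.integral_of_le zero_le_one, integral_Icc_eq_integral_Ioc]

namespace IsSquareCell

variable {z : Fin 4 → Plane} (hz : IsSquareCell z)
include hz

theorem bilin_eq (x : Plane) : bilin z x = z 0 + (x 0 • (z 1 - z 0) + x 1 • (z 3 - z 0)) := by
  ext k
  rw [bilin_apply, hz.two_apply]
  simp
  ring

/-- Change of variables: the Jacobian determinant is the constant `orientation z * sideSq z`. -/
theorem setIntegral_cell (f : Plane → ℝ) :
    ∫ y in cell z, f y = sideSq z * ∫ x in refSquare, f (bilin z x) := by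
  let M : Matrix (Fin 2) (Fin 2) ℝ := !![z 1 0 - z 0 0, z 3 0 - z 0 0; z 1 1 - z 0 1, z 3 1 - z 0 1]
  let A : Plane →L[ℝ] Plane := (Matrix.toLpLin 2 2 M).toContinuousLinearMap
  have hA : ∀ x, bilin z x = z 0 + A x := by
    intro x
    rw [hz.bilin_eq]
    congr 1
    refine plane_ext ?_ ?_
    · simp [A, M, Matrix.toLpLin_apply, dotProduct, Fin.sum_univ_two]
      ring
    · simp [A, M, Matrix.toLpLin_apply, dotProduct, Fin.sum_univ_two]
      ring
  have hdet : |A.det| = sideSq z := by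
    have h1 : A.det = M.det := by
      change LinearMap.det (Matrix.toLpLin 2 2 M) = M.det
      rw [Matrix.toLpLin_eq_toLin, LinearMap.det_toLin]
    have h2 : M.det = orientation z * sideSq z := by
      rw [hz.orientation_mul_sideSq, Matrix.det_fin_two_of]
      ring
    rw [h1, h2, abs_mul, abs_of_pos hz.sideSq_pos]
    rcases hz.orientation_eq_or with h | h <;> rw [h] <;> simp
  have hder : ∀ x ∈ refSquare, HasFDerivWithinAt (bilin z) A refSquare x := by
    intro x _
    rw [show bilin z = fun x => z 0 + A x from funext hA]
    exact (A.hasFDerivAt.const_add _).hasFDerivWithinAt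
  have hinj : InjOn (bilin z) refSquare := fun x _ y _ h => by
    rw [← hz.chart_bilin x, h, hz.chart_bilin]
  rw [cell, integral_image_eq_integral_abs_det_fderiv_smul volume
    isCompact_refSquare.isClosed.measurableSet hder hinj f]
  simp only [hdet, smul_eq_mul]
  rw [integral_const_mul]

theorem hasDerivAt_comp_bilin {F : Plane → ℝ} (hF : ContDiff ℝ 1 F) (s t : ℝ) :
    HasDerivAt (fun r => F (bilin z !₂[r, t])) (fderiv ℝ F (bilin z !₂[s, t]) (z 1 - z 0)) s ∧
      HasDerivAt (fun r => F (bilin z !₂[s, r])) (fderiv ℝ F (bilin z !₂[s, t]) (z 3 - z 0)) t := by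
  have hd := (hF.differentiable one_ne_zero (bilin z !₂[s, t])).hasFDerivAt
  constructor
  · refine hd.comp_hasDerivAt_of_eq s ?_ rfl
    have h : (fun r : ℝ => bilin z !₂[r, t]) =
        fun r => z 0 + (r • (z 1 - z 0) + t • (z 3 - z 0)) := by
      funext r; rw [hz.bilin_eq]; simp
    rw [h]
    have := (((hasDerivAt_id s).smul_const (z 1 - z 0)).add_const (t • (z 3 - z 0))).const_add (z 0)
    rwa [one_smul] at this
  · refine hd.comp_hasDerivAt_of_eq t ?_ rfl
    have h : (fun r : ℝ => bilin z !₂[s, r]) =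
        fun r => z 0 + (s • (z 1 - z 0) + r • (z 3 - z 0)) := by
      funext r; rw [hz.bilin_eq]; simp
    rw [h]
    have := (((hasDerivAt_id t).smul_const (z 3 - z 0)).const_add (s • (z 1 - z 0))).const_add (z 0)
    rwa [one_smul] at this

/-- In reference coordinates the integrand is a partial derivative in the first variable. The
fundamental theorem of calculus on each horizontal line leaves the means over the two opposite
edges. -/
theorem setIntegral_fderiv_first {F : Plane → ℝ} (hF : ContDiff ℝ 1 F) :
    ∫ y in cell z, fderiv ℝ F y (z 1 - z 0) =
      sideSq z * (edgeMean F (z 1) (z 2) - edgeMean F (z 3) (z 0)) := by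
  have hF' : Continuous fun y => fderiv ℝ F y (z 1 - z 0) :=
    (hF.continuous_fderiv one_ne_zero).clm_apply continuous_const
  have hFb : Continuous fun x => F (bilin z x) := hF.continuous.comp (continuous_bilin z)
  have hFc : Continuous fun x => fderiv ℝ F (bilin z x) (z 1 - z 0) := hF'.comp (continuous_bilin z)
  rw [hz.setIntegral_cell, setIntegral_refSquare_swap hFc]
  congr 1
  have h1 : ∀ t : ℝ, ∫ s in (0 : ℝ)..1, fderiv ℝ F (bilin z !₂[s, t]) (z 1 - z 0) =
      F (bilin z !₂[1, t]) - F (bilin z !₂[0, t]) := by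
    intro t
    refine intervalIntegral.integral_eq_sub_of_hasDerivAt
      (fun s _ => (hz.hasDerivAt_comp_bilin hF s t).1) ?_
    exact Continuous.intervalIntegrable (hFc.comp
      (continuous_plane_mk continuous_id continuous_const)) _ _
  simp only [h1]
  have hi : ∀ r : ℝ, IntervalIntegrable (fun t => F (bilin z !₂[r, t])) volume 0 1 := fun r =>
    Continuous.intervalIntegrable (hFb.comp (continuous_plane_mk continuous_const continuous_id)) _ _
  rw [intervalIntegral.integral_sub (hi 1) (hi 0),
    edgeMean_comm F (z 3) (z 0)]
  congr 1
  · refine intervalIntegral.integral_congr fun t _ => congrArg F ?_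
    ext k
    rw [lineMap_apply_coord, bilin_apply, hz.two_apply]
    simp
    ring
  · refine intervalIntegral.integral_congr fun t _ => congrArg F ?_
    ext k
    rw [lineMap_apply_coord, bilin_apply]
    simp
    ring

theorem setIntegral_fderiv_second {F : Plane → ℝ} (hF : ContDiff ℝ 1 F) :
    ∫ y in cell z, fderiv ℝ F y (z 3 - z 0) =
      sideSq z * (edgeMean F (z 2) (z 3) - edgeMean F (z 0) (z 1)) := by
  have hF' : Continuous fun y => fderiv ℝ F y (z 3 - z 0) :=
    (hF.continuous_fderiv one_ne_zero).clm_apply continuous_const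
  have hFb : Continuous fun x => F (bilin z x) := hF.continuous.comp (continuous_bilin z)
  have hFc : Continuous fun x => fderiv ℝ F (bilin z x) (z 3 - z 0) := hF'.comp (continuous_bilin z)
  rw [hz.setIntegral_cell, setIntegral_refSquare hFc]
  congr 1
  have h1 : ∀ s : ℝ, ∫ t in (0 : ℝ)..1, fderiv ℝ F (bilin z !₂[s, t]) (z 3 - z 0) =
      F (bilin z !₂[s, 1]) - F (bilin z !₂[s, 0]) := by
    intro s
    refine intervalIntegral.integral_eq_sub_of_hasDerivAt
      (fun t _ => (hz.hasDerivAt_comp_bilin hF s t).2) ?_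
    exact Continuous.intervalIntegrable (hFc.comp
      (continuous_plane_mk continuous_const continuous_id)) _ _
  simp only [h1]
  have hi : ∀ r : ℝ, IntervalIntegrable (fun t => F (bilin z !₂[t, r])) volume 0 1 := fun r =>
    Continuous.intervalIntegrable (hFb.comp (continuous_plane_mk continuous_id continuous_const)) _ _
  rw [intervalIntegral.integral_sub (hi 1) (hi 0),
    edgeMean_comm F (z 2) (z 3)]
  congr 1
  · refine intervalIntegral.integral_congr fun t _ => congrArg F ?_
    ext k
    rw [lineMap_apply_coord, bilin_apply, hz.two_apply]
    simp
    ring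
  · refine intervalIntegral.integral_congr fun t _ => congrArg F ?_
    ext k
    rw [lineMap_apply_coord, bilin_apply]
    simp
    ring

/-- The divergence theorem on a square. -/
theorem setIntegral_fderiv {F : Plane → ℝ} (hF : ContDiff ℝ 1 F) (v : Plane) :
    ∫ y in cell z, fderiv ℝ F y v =
      orientation z * ∑ p, cross v (z (p + 1) - z p) * edgeMean F (z p) (z (p + 1)) := by
  have hN := hz.sideSq_pos.ne'
  have ho := hz.orientation_sq
  -- By linearity it suffices to differentiate along the two sides. Up to the orientation, `cross v`
  -- of an edge vector is the flux of the constant field `v` through that edge.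
  obtain ⟨s, t, hv⟩ : ∃ s t : ℝ, v = s • (z 1 - z 0) + t • (z 3 - z 0) := by
    refine ⟨chart z (z 0 + v) 0, chart z (z 0 + v) 1, ?_⟩
    have := hz.bilin_eq (chart z (z 0 + v))
    rw [hz.bilin_chart] at this
    exact add_left_cancel this
  have hc : ∀ w, IntegrableOn (fun y => fderiv ℝ F y w) (cell z) := fun w =>
    ((hF.continuous_fderiv one_ne_zero).clm_apply continuous_const).continuousOn.integrableOn_compact
      (isCompact_cell z)
  have h1 : ∫ y in cell z, fderiv ℝ F y v = s * (∫ y in cell z, fderiv ℝ F y (z 1 - z 0)) +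
      t * ∫ y in cell z, fderiv ℝ F y (z 3 - z 0) := by
    rw [hv, ← integral_const_mul, ← integral_const_mul,
      ← integral_add ((hc _).const_mul s) ((hc _).const_mul t)]
    simp only [map_add, map_smul, smul_eq_mul]
  rw [h1, hz.setIntegral_fderiv_first hF, hz.setIntegral_fderiv_second hF, Fin.sum_univ_four]
  have e1 : (3 : Fin 4) + 1 = 0 := rfl
  have e2 : (2 : Fin 4) + 1 = 3 := rfl
  have e3 : (1 : Fin 4) + 1 = 2 := rfl
  have e4 : (0 : Fin 4) + 1 = 1 := rfl
  have hv0 := congrArg (fun w : Plane => w 0) hv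
  have hv1 := congrArg (fun w : Plane => w 1) hv
  simp only [PiLp.add_apply, PiLp.smul_apply, PiLp.sub_apply, smul_eq_mul] at hv0 hv1
  simp only [e1, e2, e3, e4, cross, PiLp.sub_apply, hv0, hv1, hz.two_apply, hz.three_zero,
    hz.three_one, sideSq]
  generalize edgeMean F (z 0) (z 1) = A
  generalize edgeMean F (z 1) (z 2) = B
  generalize edgeMean F (z 2) (z 3) = C
  generalize edgeMean F (z 3) (z 0) = D
  linear_combination (-((z 1 0 - z 0 0) ^ 2 + (z 1 1 - z 0 1) ^ 2) * (s * (B - D) + t * (C - A))) * ho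

end IsSquareCell

/-! ### Harmonic quadratics on squares -/

/-- The quadratic polynomials spanned by `1, x, y, xy, x² - y²`. -/
def quad (α : Fin 5 → ℝ) (x : Plane) : ℝ :=
  α 0 + α 1 * x 0 + α 2 * x 1 + α 3 * (x 0 * x 1) + α 4 * (x 0 ^ 2 - x 1 ^ 2)

/-- The pushforward of `quad α` to a square. -/
noncomputable def cellFun (z : Fin 4 → Plane) (α : Fin 5 → ℝ) (y : Plane) : ℝ := quad α (chart z y)

/-- The gradient of `cellFun z α`. -/
noncomputable def cellGrad (z : Fin 4 → Plane) (α : Fin 5 → ℝ) (y : Plane) : Plane :=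
  (sideSq z)⁻¹ • ((α 1 + α 3 * chart z y 1 + 2 * α 4 * chart z y 0) • (z 1 - z 0) +
    (α 2 + α 3 * chart z y 0 - 2 * α 4 * chart z y 1) • (z 3 - z 0))

/-- The rotation that turns the gradient of a function into its `Curl`. -/
noncomputable def turn (v : Plane) : Plane := !₂[v 1, -v 0]

theorem inner_plane (v w : Plane) : inner ℝ v w = v 0 * w 0 + v 1 * w 1 := by
  simp only [PiLp.inner_apply, Fin.sum_univ_two, RCLike.inner_apply, conj_trivial]
  ring

theorem chart_zero_eq_inner (z : Fin 4 → Plane) (y : Plane) :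
    chart z y 0 = (sideSq z)⁻¹ * inner ℝ (z 1 - z 0) (y - z 0) := by
  rw [chart_zero, inner_plane, div_eq_inv_mul]; rfl

theorem chart_one_eq_inner (z : Fin 4 → Plane) (y : Plane) :
    chart z y 1 = (sideSq z)⁻¹ * inner ℝ (z 3 - z 0) (y - z 0) := by
  rw [chart_one, inner_plane, div_eq_inv_mul]; rfl

theorem contDiff_chart_apply (z : Fin 4 → Plane) (k : Fin 2) {n : WithTop ℕ∞} :
    ContDiff ℝ n fun y => chart z y k := by
  fin_cases k
  · simp only [Fin.zero_eta, chart_zero_eq_inner]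
    exact contDiff_const.mul (contDiff_const.inner ℝ (contDiff_id.sub contDiff_const))
  · simp only [Fin.mk_one, chart_one_eq_inner]
    exact contDiff_const.mul (contDiff_const.inner ℝ (contDiff_id.sub contDiff_const))

theorem contDiff_cellFun (z : Fin 4 → Plane) (α : Fin 5 → ℝ) {n : WithTop ℕ∞} :
    ContDiff ℝ n (cellFun z α) := by
  have h0 := contDiff_chart_apply z 0 (n := n)
  have h1 := contDiff_chart_apply z 1 (n := n)
  unfold cellFun quad
  fun_prop

theorem continuous_cellFun (z : Fin 4 → Plane) (α : Fin 5 → ℝ) : Continuous (cellFun z α) :=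
  (contDiff_cellFun z α (n := 0)).continuous

theorem continuous_cellGrad (z : Fin 4 → Plane) (α : Fin 5 → ℝ) : Continuous (cellGrad z α) := by
  have h0 := (contDiff_chart_apply z 0 (n := 0)).continuous
  have h1 := (contDiff_chart_apply z 1 (n := 0)).continuous
  unfold cellGrad
  fun_prop

theorem continuous_turn : Continuous turn :=
  continuous_plane_mk (plane_continuous_apply 1) (plane_continuous_apply 0).neg

theorem hasFDerivAt_cellFun (z : Fin 4 → Plane) (α : Fin 5 → ℝ) (y : Plane) :
    HasFDerivAt (cellFun z α) (innerSL ℝ (cellGrad z α y)) y := by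
  have h0 : HasFDerivAt (fun y => chart z y 0) ((sideSq z)⁻¹ • innerSL ℝ (z 1 - z 0)) y := by
    simp only [chart_zero_eq_inner]
    exact (((innerSL ℝ (z 1 - z 0)).hasFDerivAt.comp y
      ((hasFDerivAt_id y).sub_const (z 0))).const_mul (sideSq z)⁻¹)
  have h1 : HasFDerivAt (fun y => chart z y 1) ((sideSq z)⁻¹ • innerSL ℝ (z 3 - z 0)) y := by
    simp only [chart_one_eq_inner]
    exact (((innerSL ℝ (z 3 - z 0)).hasFDerivAt.comp y
      ((hasFDerivAt_id y).sub_const (z 0))).const_mul (sideSq z)⁻¹)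
  have h := ((((h0.const_mul (α 1)).const_add (α 0)).add (h1.const_mul (α 2))).add
    ((h0.mul h1).const_mul (α 3))).add (((h0.pow 2).sub (h1.pow 2)).const_mul (α 4))
  refine h.congr_fderiv ?_
  ext v
  simp only [add_apply, sub_apply,
    smul_apply, innerSL_apply_apply, smul_eq_mul, cellGrad, inner_smul_left,
    inner_add_left, conj_trivial]
  simp
  ring

theorem cellFun_add (z : Fin 4 → Plane) (α β : Fin 5 → ℝ) (y : Plane) :
    cellFun z (α + β) y = cellFun z α y + cellFun z β y := by
  simp only [cellFun, quad, Pi.add_apply]; ring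

theorem cellFun_const (z : Fin 4 → Plane) (r : ℝ) (y : Plane) :
    cellFun z ![r, 0, 0, 0, 0] y = r := by
  simp [cellFun, quad]

theorem integral_quadratic (a b c : ℝ) :
    ∫ t in (0 : ℝ)..1, (a + b * t + c * t ^ 2) = a + b / 2 + c / 3 := by
  rw [intervalIntegral.integral_add, intervalIntegral.integral_add,
    intervalIntegral.integral_const_mul, intervalIntegral.integral_const_mul, integral_pow]
  · simp
    ring
  all_goals exact Continuous.intervalIntegrable (by fun_prop) _ _

theorem edgeMean_quad_zero (α : Fin 5 → ℝ) :
    edgeMean (quad α) (corner 0) (corner 1) = α 0 + α 1 / 2 + α 4 / 3 := by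
  rw [← integral_quadratic]
  refine intervalIntegral.integral_congr fun t _ => ?_
  simp only [quad, lineMap_apply_coord]
  simp [corner]

theorem edgeMean_quad_one (α : Fin 5 → ℝ) :
    edgeMean (quad α) (corner 1) (corner 2) =
    (α 0 + α 1 + α 4) + (α 2 + α 3) / 2 + (-α 4) / 3 := by
  rw [← integral_quadratic]
  refine intervalIntegral.integral_congr fun t _ => ?_
  simp only [quad, lineMap_apply_coord]
  simp [corner]
  ring

theorem edgeMean_quad_two (α : Fin 5 → ℝ) :
    edgeMean (quad α) (corner 2) (corner 3) =
    (α 0 + α 1 + α 2 + α 3) + (-α 1 - α 3 - 2 * α 4) / 2 + α 4 / 3 := by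
  rw [← integral_quadratic]
  refine intervalIntegral.integral_congr fun t _ => ?_
  simp only [quad, lineMap_apply_coord]
  simp [corner]
  ring

theorem edgeMean_quad_three (α : Fin 5 → ℝ) :
    edgeMean (quad α) (corner 3) (corner 0) =
    (α 0 + α 2 - α 4) + (-α 2 + 2 * α 4) / 2 + (-α 4) / 3 := by
  rw [← integral_quadratic]
  refine intervalIntegral.integral_congr fun t _ => ?_
  simp only [quad, lineMap_apply_coord]
  simp [corner]
  ring

/-- The integrand is the divergence of α Curl β. The normal component of Curl β on an edge is the
tangential derivative of β, which is constant there since `β 4 = 0` makes β affine on edges, so each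
edge contributes an increment times a mean. The proof evaluates both sides explicitly. -/
theorem setIntegral_refSquare_jacobian (α β : Fin 5 → ℝ) (hβ : β 4 = 0) :
    ∫ x in refSquare, ((α 1 + α 3 * x 1 + 2 * α 4 * x 0) * (β 2 + β 3 * x 0 - 2 * β 4 * x 1) -
      (α 2 + α 3 * x 0 - 2 * α 4 * x 1) * (β 1 + β 3 * x 1 + 2 * β 4 * x 0)) =
    ∑ p, (quad β (corner (p + 1)) - quad β (corner p)) *
      edgeMean (quad α) (corner p) (corner (p + 1)) := by
  have h0 := plane_continuous_apply 0
  have h1 := plane_continuous_apply 1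
  rw [setIntegral_refSquare (by fun_prop), hβ]
  simp only [Matrix.cons_val_zero, Matrix.cons_val_one]
  have e1 : ∀ s : ℝ, ∫ t in (0 : ℝ)..1, ((α 1 + α 3 * t + 2 * α 4 * s) * (β 2 + β 3 * s - 2 * 0 * t) -
      (α 2 + α 3 * s - 2 * α 4 * t) * (β 1 + β 3 * t + 2 * 0 * s)) =
      (α 1 * β 2 - α 2 * β 1 + (α 3 * β 2 + 2 * α 4 * β 1 - α 2 * β 3) / 2 + 2 * α 4 * β 3 / 3) +
      (α 1 * β 3 + 2 * α 4 * β 2 - α 3 * β 1) * s + (2 * α 4 * β 3) * s ^ 2 := by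
    intro s
    have : ∀ t : ℝ, ((α 1 + α 3 * t + 2 * α 4 * s) * (β 2 + β 3 * s - 2 * 0 * t) -
      (α 2 + α 3 * s - 2 * α 4 * t) * (β 1 + β 3 * t + 2 * 0 * s)) =
      ((α 1 + 2 * α 4 * s) * (β 2 + β 3 * s) - (α 2 + α 3 * s) * β 1) +
      (α 3 * (β 2 + β 3 * s) - (α 2 + α 3 * s) * β 3 + 2 * α 4 * β 1) * t +
      (2 * α 4 * β 3) * t ^ 2 := fun t => by ring
    simp only [this, integral_quadratic]
    ring
  simp only [e1, integral_quadratic]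
  have f1 : (3 : Fin 4) + 1 = 0 := rfl
  have f2 : (2 : Fin 4) + 1 = 3 := rfl
  have f3 : (1 : Fin 4) + 1 = 2 := rfl
  have f4 : (0 : Fin 4) + 1 = 1 := rfl
  rw [Fin.sum_univ_four, f1, f2, f3, f4, edgeMean_quad_zero,
    edgeMean_quad_one, edgeMean_quad_two, edgeMean_quad_three]
  simp [quad, corner, hβ]
  ring

namespace IsSquareCell

variable {z : Fin 4 → Plane} (hz : IsSquareCell z)
include hz

theorem cellFun_vertex (α : Fin 5 → ℝ) (p : Fin 4) : cellFun z α (z p) = quad α (corner p) := by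
  rw [cellFun, hz.chart_vertex]

theorem edgeMean_cellFun (α : Fin 5 → ℝ) (p : Fin 4) :
    edgeMean (cellFun z α) (z p) (z (p + 1)) = edgeMean (quad α) (corner p) (corner (p + 1)) := by
  unfold edgeMean cellFun
  simp only [hz.chart_lineMap, hz.chart_vertex]

theorem cellFun_edge {α : Fin 5 → ℝ} (hα : α 4 = 0) (p : Fin 4) (t : ℝ) :
    cellFun z α (AffineMap.lineMap (z p) (z (p + 1)) t) =
      cellFun z α (z p) + t * (cellFun z α (z (p + 1)) - cellFun z α (z p)) := by
  simp only [cellFun, hz.chart_lineMap, hz.chart_vertex, quad, lineMap_apply_coord, hα]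
  have f1 : (3 : Fin 4) + 1 = 0 := rfl
  have f2 : (2 : Fin 4) + 1 = 3 := rfl
  have f3 : (1 : Fin 4) + 1 = 2 := rfl
  fin_cases p <;> simp [corner, f1, f2, f3] <;> ring

/-- The product v · `turn` w is the determinant of v and w, so the left side is a Jacobian
determinant and scales with that of the chart. -/
theorem inner_cellGrad_turn (α β : Fin 5 → ℝ) (x : Plane) :
    inner ℝ (cellGrad z α (bilin z x)) (turn (cellGrad z β (bilin z x))) =
      (sideSq z)⁻¹ * orientation z *
      ((α 1 + α 3 * x 1 + 2 * α 4 * x 0) * (β 2 + β 3 * x 0 - 2 * β 4 * x 1) -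
        (α 2 + α 3 * x 0 - 2 * α 4 * x 1) * (β 1 + β 3 * x 1 + 2 * β 4 * x 0)) := by
  have hN := hz.sideSq_pos.ne'
  simp only [inner_plane, cellGrad, turn, hz.chart_bilin, PiLp.add_apply, PiLp.smul_apply,
    PiLp.sub_apply, smul_eq_mul, hz.three_zero, hz.three_one, Matrix.cons_val_zero,
    Matrix.cons_val_one]
  field_simp
  rw [sideSq]
  ring

theorem setIntegral_inner_cellGrad_turn (α : Fin 5 → ℝ) {β : Fin 5 → ℝ} (hβ : β 4 = 0) :
    ∫ y in cell z, inner ℝ (cellGrad z α y) (turn (cellGrad z β y)) =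
      orientation z * ∑ p, (cellFun z β (z (p + 1)) - cellFun z β (z p)) *
        edgeMean (cellFun z α) (z p) (z (p + 1)) := by
  rw [hz.setIntegral_cell]
  simp only [hz.inner_cellGrad_turn, hz.edgeMean_cellFun, hz.cellFun_vertex]
  rw [integral_const_mul, setIntegral_refSquare_jacobian α β hβ, ← mul_assoc, ← mul_assoc,
    mul_inv_cancel₀ hz.sideSq_pos.ne', one_mul]

end IsSquareCell

/-! ### Piecewise functions on a square partition -/

/-- The class `u` is represented by `F` on the cell `z`. -/
def EqOnCell {E : Type*} [NormedAddCommGroup E] (Ω : Set Plane) (z : Fin 4 → Plane) (u : L2 Ω E)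
    (F : Plane → E) : Prop :=
  ∀ᵐ y ∂(volume : Measure Plane).restrict Ω, y ∈ cell z → u y = F y

theorem EqOnCell.congr {E : Type*} [NormedAddCommGroup E] {Ω : Set Plane} {z : Fin 4 → Plane}
    {u : L2 Ω E} {F G : Plane → E} (h : EqOnCell Ω z u F) (hFG : ∀ y ∈ cell z, F y = G y) :
    EqOnCell Ω z u G := by
  filter_upwards [h] with y hy hyz
  rw [hy hyz, hFG y hyz]

theorem measurableSet_cell (z : Fin 4 → Plane) : MeasurableSet (cell z) :=
  (isCompact_cell z).isClosed.measurableSet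

theorem EqOnCell.ae_restrict {E : Type*} [NormedAddCommGroup E] {Ω : Set Plane}
    {z : Fin 4 → Plane} (hz : IsSquareCell z) (hzΩ : interior (cell z) ⊆ Ω) {u : L2 Ω E}
    {F : Plane → E} (h : EqOnCell Ω z u F) : ∀ᵐ y ∂volume.restrict (cell z), u y = F y := by
  rw [← Measure.restrict_congr_set hz.interior_cell_ae_eq]
  filter_upwards [ae_restrict_of_ae_restrict_of_subset hzΩ h,
    ae_restrict_mem isOpen_interior.measurableSet] with y hy hyz
  exact hy (interior_subset hyz)

namespace IsSquareMesh

variable {ι : Type*} {Ω : Set Plane} {z : ι → Fin 4 → Plane} (hM : IsSquareMesh Ω z)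
include hM

theorem ae_mem_interior (i : ι) :
    ∀ᵐ y ∂(volume : Measure Plane), y ∈ cell (z i) → y ∈ interior (cell (z i)) := by
  have h := (hM.square i).interior_cell_ae_eq
  filter_upwards [h] with y hy hyz
  exact hy.mpr hyz

theorem ae_eq_iUnion [Finite ι] : Ω =ᵐ[volume] ⋃ i, cell (z i) := by
  refine Filter.EventuallyLE.antisymm ?_ ?_
  · exact LE.le.eventuallyLE fun y hy => mem_iUnion.2 (hM.exists_mem_cell hy)
  · have h : ∀ᵐ y ∂(volume : Measure Plane), ∀ i, y ∈ cell (z i) → y ∈ interior (cell (z i)) :=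
      ae_all_iff.2 fun i => hM.ae_mem_interior i
    filter_upwards [h] with y hy hyU
    obtain ⟨i, hi⟩ := mem_iUnion.1 hyU
    exact hM.interior_cell_subset i (hy i hi)

theorem aedisjoint_cell {i j : ι} (hij : i ≠ j) : AEDisjoint volume (cell (z i)) (cell (z j)) :=
  ((hM.disjoint_interior hij).aedisjoint).congr (hM.square i).interior_cell_ae_eq.symm
    (hM.square j).interior_cell_ae_eq.symm

theorem setIntegral_eq_sum [Fintype ι] {E : Type*} [NormedAddCommGroup E] [NormedSpace ℝ E]
    {f : Plane → E} (hf : IntegrableOn f Ω) : ∫ y in Ω, f y = ∑ i, ∫ y in cell (z i), f y := by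
  have h := hf.congr_set_ae hM.ae_eq_iUnion.symm
  rw [setIntegral_congr_set hM.ae_eq_iUnion, integral_iUnion_ae
    (fun i => (measurableSet_cell (z i)).nullMeasurableSet)
    (fun i j hij => hM.aedisjoint_cell hij) h, tsum_fintype]

theorem isFiniteMeasure [Finite ι] : IsFiniteMeasure ((volume : Measure Plane).restrict Ω) := by
  refine ⟨?_⟩
  rw [Measure.restrict_apply_univ]
  refine lt_of_le_of_lt (measure_mono (subset_closure.trans hM.partition.1.subset)) ?_
  exact (isCompact_iUnion fun i => isCompact_cell (z i)).measure_lt_top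

theorem exists_piecewise [Finite ι] {E : Type*} [NormedAddCommGroup E] (F : ι → Plane → E)
    (hF : ∀ i, Continuous (F i)) : ∃ u : L2 Ω E, ∀ i, EqOnCell Ω (z i) u (F i) := by
  classical
  have := Fintype.ofFinite ι
  have := hM.isFiniteMeasure
  -- The interiors are disjoint, so at most one summand is nonzero; with closed cells the shared
  -- edges would be counted repeatedly.
  let f : Plane → E := fun y => ∑ i, (interior (cell (z i))).indicator (F i) y
  have hf : MemLp f 2 (volume.restrict Ω) := by
    refine memLp_finsetSum _ fun i _ => ?_
    obtain ⟨C, hC⟩ := (isCompact_cell (z i)).exists_bound_of_continuousOn (hF i).continuousOn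
    refine MemLp.of_bound (((hF i).aestronglyMeasurable).indicator isOpen_interior.measurableSet)
      (max C 0) (Filter.Eventually.of_forall fun y => ?_)
    by_cases hy : y ∈ interior (cell (z i))
    · rw [indicator_of_mem hy]
      exact (hC y (interior_subset hy)).trans (le_max_left _ _)
    · rw [indicator_of_notMem hy, norm_zero]
      exact le_max_right _ _
  refine ⟨hf.toLp f, fun i => ?_⟩
  filter_upwards [hf.coeFn_toLp, ae_restrict_of_ae (hM.ae_mem_interior i)] with y hy hyi hyz
  have hyi := hyi hyz
  rw [hy]
  change ∑ j, (interior (cell (z j))).indicator (F j) y = F i y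
  rw [Finset.sum_eq_single i, indicator_of_mem hyi]
  · intro j _ hji
    exact indicator_of_notMem (fun h => (Set.disjoint_left.1 (hM.disjoint_interior hji) h hyi)) _
  · intro h; exact (h (Finset.mem_univ _)).elim

theorem ae_eq_of_eqOnCell [Finite ι] {E : Type*} [NormedAddCommGroup E] {u v : L2 Ω E}
    {F : ι → Plane → E} (hu : ∀ i, EqOnCell Ω (z i) u (F i))
    (hv : ∀ i, EqOnCell Ω (z i) v (F i)) : u = v := by
  refine Lp.ext ?_
  filter_upwards [ae_all_iff.2 hu, ae_all_iff.2 hv, ae_restrict_mem hM.isOpen.measurableSet]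
    with y h1 h2 hy
  obtain ⟨i, hi⟩ := hM.exists_mem_cell hy
  rw [h1 i hi, h2 i hi]

theorem setIntegral_cell_congr {E : Type*} [NormedAddCommGroup E] {u : L2 Ω E} {i : ι}
    {F : Plane → E} (hu : EqOnCell Ω (z i) u F) (Φ : E → Plane → ℝ) :
    ∫ y in cell (z i), Φ (u y) y = ∫ y in cell (z i), Φ (F y) y := by
  refine integral_congr_ae ?_
  filter_upwards [hu.ae_restrict (hM.square i) (hM.interior_cell_subset i)] with y hy
  rw [hy]

theorem inner_eq_sum [Fintype ι] {u v : L2 Ω Plane} {F G : ι → Plane → Plane}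
    (hu : ∀ i, EqOnCell Ω (z i) u (F i)) (hv : ∀ i, EqOnCell Ω (z i) v (G i)) :
    inner ℝ u v = ∑ i, ∫ y in cell (z i), inner ℝ (F i y) (G i y) := by
  have h : IntegrableOn (fun y => inner ℝ (u y) (v y)) Ω := L2.integrable_inner u v
  rw [L2.inner_def, hM.setIntegral_eq_sum h]
  refine Finset.sum_congr rfl fun i _ => ?_
  refine integral_congr_ae ?_
  filter_upwards [(hu i).ae_restrict (hM.square i) (hM.interior_cell_subset i),
    (hv i).ae_restrict (hM.square i) (hM.interior_cell_subset i)] with y h1 h2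
  rw [h1, h2]

end IsSquareMesh

/-! ### Weak gradients of piecewise functions -/

/-- The divergence theorem applied to the product with φ. -/
theorem IsSquareCell.setIntegral_by_parts {z : Fin 4 → Plane} (hz : IsSquareCell z)
    (α : Fin 5 → ℝ) {φ : Plane → ℝ} (hφ : ContDiff ℝ ∞ φ) (v : Plane) :
    (∫ y in cell z, cellFun z α y * fderiv ℝ φ y v) +
        ∫ y in cell z, inner ℝ (cellGrad z α y) v * φ y =
      orientation z * ∑ p, cross v (z (p + 1) - z p) *
        edgeMean (fun y => cellFun z α y * φ y) (z p) (z (p + 1)) := by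
  have hφ1 : ContDiff ℝ 1 φ := hφ.of_le (by exact_mod_cast le_top)
  have hd : Continuous fun y => fderiv ℝ φ y v :=
    (hφ1.continuous_fderiv one_ne_zero).clm_apply continuous_const
  rw [← hz.setIntegral_fderiv ((contDiff_cellFun z α).mul hφ1) v, ← integral_add]
  · refine integral_congr_ae (Filter.Eventually.of_forall fun y => ?_)
    have h := (hasFDerivAt_cellFun z α y).mul (hφ1.differentiable one_ne_zero y).hasFDerivAt
    change _ = fderiv ℝ (cellFun z α * φ) y v
    rw [h.fderiv]
    simp
    ring
  · exact ((continuous_cellFun z α).mul hd).continuousOn.integrableOn_compact (isCompact_cell z)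
  · exact (((continuous_cellGrad z α).inner continuous_const).mul
      hφ1.continuous).continuousOn.integrableOn_compact (isCompact_cell z)

theorem setIntegral_eq_cell {z : Fin 4 → Plane} (hz : IsSquareCell z) {Ω : Set Plane}
    (hO : IsOpen Ω) (hzΩ : interior (cell z) ⊆ Ω) {f : Plane → ℝ}
    (hf : ∀ y, y ∉ interior (cell z) → f y = 0) : ∫ y in Ω, f y = ∫ y in cell z, f y := by
  rw [setIntegral_eq_of_subset_of_forall_sdiff_eq_zero hO.measurableSet hzΩ fun y hy => hf y hy.2,
    setIntegral_congr_set hz.interior_cell_ae_eq]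

theorem notMem_tsupport_fderiv {φ : Plane → ℝ} {y : Plane} (h : y ∉ tsupport φ) (v : Plane) :
    fderiv ℝ φ y v = 0 := by
  have : fderiv ℝ φ y = 0 := image_eq_zero_of_notMem_tsupport fun h' =>
    h (tsupport_fderiv_subset ℝ h')
  rw [this]; rfl

/-- Integration by parts on a single cell against a test function supported in the cell. -/
theorem EqOnCell.setIntegral_mul_fderiv {z : Fin 4 → Plane} (hz : IsSquareCell z) {Ω : Set Plane}
    (hO : IsOpen Ω) (hzΩ : interior (cell z) ⊆ Ω) {u : L2 Ω ℝ} {α : Fin 5 → ℝ}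
    (hu : EqOnCell Ω z u (cellFun z α)) {φ : Plane → ℝ} (hφ : ContDiff ℝ ∞ φ)
    (hs : tsupport φ ⊆ interior (cell z)) (v : Plane) :
    ∫ y in Ω, u y * fderiv ℝ φ y v = -∫ y in Ω, inner ℝ (cellGrad z α y) v * φ y := by
  have h0 : ∀ y, y ∉ interior (cell z) → φ y = 0 := fun y hy =>
    image_eq_zero_of_notMem_tsupport fun h => hy (hs h)
  have h1 : ∀ y, y ∉ interior (cell z) → fderiv ℝ φ y v = 0 := fun y hy =>
    notMem_tsupport_fderiv (fun h => hy (hs h)) v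
  have h2 := hz.setIntegral_by_parts α hφ v
  have h3 : ∀ p, edgeMean (fun y => cellFun z α y * φ y) (z p) (z (p + 1)) = 0 := fun p =>
    edgeMean_eq_zero fun y hy => by
      rw [h0 y (hz.edge_disjoint_interior hy), mul_zero]
  simp only [h3, mul_zero, Finset.sum_const_zero] at h2
  rw [setIntegral_eq_cell hz hO hzΩ fun y hy => by rw [h1 y hy, mul_zero],
    setIntegral_eq_cell hz hO hzΩ fun y hy => by rw [h0 y hy, mul_zero], ← add_eq_zero_iff_eq_neg,
    ← h2]
  congr 1
  refine integral_congr_ae ?_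
  filter_upwards [hu.ae_restrict hz hzΩ] with y hy
  rw [hy]

theorem inner_single_right (v : Plane) (k : Fin 2) :
    inner ℝ v (EuclideanSpace.single k (1 : ℝ)) = v k := by
  simp [EuclideanSpace.inner_single_right]

theorem EqOnCell.hasWeakGradient {z : Fin 4 → Plane} (hz : IsSquareCell z) {Ω : Set Plane}
    (hO : IsOpen Ω) (hzΩ : interior (cell z) ⊆ Ω) {u : L2 Ω ℝ} {g : L2 Ω Plane} {α : Fin 5 → ℝ}
    (hu : EqOnCell Ω z u (cellFun z α)) (hg : EqOnCell Ω z g (cellGrad z α)) :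
    HasWeakGradient Ω (interior (cell z)) u g := by
  intro φ hφ _ hs k
  rw [hu.setIntegral_mul_fderiv hz hO hzΩ hφ hs]
  congr 1
  refine integral_congr_ae ?_
  filter_upwards [hg] with y hy
  rw [inner_single_right]
  by_cases hyz : y ∈ cell z
  · rw [hy hyz]
  · have : φ y = 0 := image_eq_zero_of_notMem_tsupport fun h => hyz (interior_subset (hs h))
    rw [this, mul_zero, mul_zero]

theorem HasWeakGradient.mono {Ω U V : Set Plane} {u : L2 Ω ℝ} {g : L2 Ω Plane} (hUV : U ⊆ V)
    (h : HasWeakGradient Ω V u g) : HasWeakGradient Ω U u g :=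
  fun φ hφ hc hs k => h φ hφ hc (hs.trans hUV) k

/-- Weak gradients are unique: the difference from the classical gradient vanishes against all test
functions in the open cell, and the boundary of the cell is null. -/
theorem HasWeakGradient.eqOnCell {z : Fin 4 → Plane} (hz : IsSquareCell z) {Ω : Set Plane}
    (hO : IsOpen Ω) (hzΩ : interior (cell z) ⊆ Ω) {u : L2 Ω ℝ} {g : L2 Ω Plane} {α : Fin 5 → ℝ}
    (hu : EqOnCell Ω z u (cellFun z α)) (h : HasWeakGradient Ω (interior (cell z)) u g) :
    EqOnCell Ω z g (cellGrad z α) := by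
  have key : ∀ k : Fin 2, ∀ᵐ y ∂(volume : Measure Plane).restrict Ω, y ∈ interior (cell z) →
      g y k - cellGrad z α y k = 0 := by
    intro k
    have hg : LocallyIntegrable (fun y => g y k) (volume.restrict Ω) :=
      ((EuclideanSpace.proj (𝕜 := ℝ) k : Plane →L[ℝ] ℝ).comp_memLp' (Lp.memLp g)).locallyIntegrable
        one_le_two
    have hc : Continuous fun y => cellGrad z α y k :=
      (plane_continuous_apply k).comp (continuous_cellGrad z α)
    refine isOpen_interior.ae_eq_zero_of_integral_contDiff_smul_eq_zero
      ((hg.sub hc.locallyIntegrable).locallyIntegrableOn _) fun φ hφ hφc hs => ?_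
    have h1 := h φ hφ hφc hs k
    rw [hu.setIntegral_mul_fderiv hz hO hzΩ hφ hs, neg_inj] at h1
    simp only [inner_single_right] at h1
    have i1 : Integrable (fun y => g y k * φ y) (volume.restrict Ω) :=
      integrable_L2_coord_mul g k hφ.continuous hφc
    have i2 : Integrable (fun y => cellGrad z α y k * φ y) (volume.restrict Ω) :=
      ((hc.mul hφ.continuous).integrable_of_hasCompactSupport hφc.mul_left).restrict
    calc ∫ y in Ω, φ y • (g y k - cellGrad z α y k)
        = ∫ y in Ω, (g y k * φ y - cellGrad z α y k * φ y) := by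
          refine integral_congr_ae (Filter.Eventually.of_forall fun y => ?_)
          simp only [smul_eq_mul]
          ring
      _ = 0 := by rw [integral_sub i1 i2, h1, sub_self]
  have hint : ∀ᵐ y ∂(volume : Measure Plane).restrict Ω, y ∈ cell z → y ∈ interior (cell z) := by
    refine ae_restrict_of_ae ?_
    filter_upwards [hz.interior_cell_ae_eq] with y hy hyz
    exact hy.mpr hyz
  filter_upwards [key 0, key 1, hint] with y h0 h1 hy hyz
  exact plane_ext (sub_eq_zero.1 (h0 (hy hyz))) (sub_eq_zero.1 (h1 (hy hyz)))

namespace IsSquareMesh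

variable {ι : Type*} {Ω : Set Plane} {z : ι → Fin 4 → Plane} (hM : IsSquareMesh Ω z)
include hM

/-- Integration by parts on all cells of the partition. -/
theorem setIntegral_by_parts [Fintype ι] {u : L2 Ω ℝ} {g : L2 Ω Plane} {α : ι → Fin 5 → ℝ}
    (hu : ∀ i, EqOnCell Ω (z i) u (cellFun (z i) (α i)))
    (hg : ∀ i, EqOnCell Ω (z i) g (cellGrad (z i) (α i))) {φ : Plane → ℝ} (hφ : ContDiff ℝ ∞ φ)
    (hφc : HasCompactSupport φ) (k : Fin 2) :
    (∫ y in Ω, u y * fderiv ℝ φ y (EuclideanSpace.single k 1)) + ∫ y in Ω, g y k * φ y =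
      ∑ i, ∑ p, orientation (z i) * (cross (EuclideanSpace.single k 1) (z i (p + 1) - z i p) *
        edgeMean (fun y => cellFun (z i) (α i) y * φ y) (z i p) (z i (p + 1))) := by
  have hd : Continuous fun y => fderiv ℝ φ y (EuclideanSpace.single k 1) :=
    (hφ.continuous_fderiv (by simp)).clm_apply continuous_const
  have i1 : IntegrableOn (fun y => u y * fderiv ℝ φ y (EuclideanSpace.single k 1)) Ω :=
    integrable_L2_mul u hd (hφc.fderiv_apply ℝ _)
  have i2 : IntegrableOn (fun y => g y k * φ y) Ω := integrable_L2_coord_mul g k hφ.continuous hφc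
  rw [hM.setIntegral_eq_sum i1, hM.setIntegral_eq_sum i2, ← Finset.sum_add_distrib]
  refine Finset.sum_congr rfl fun i _ => ?_
  rw [← Finset.mul_sum, ← (hM.square i).setIntegral_by_parts (α i) hφ]
  congr 1
  · exact hM.setIntegral_cell_congr (hu i) fun r y => r * fderiv ℝ φ y (EuclideanSpace.single k 1)
  · rw [hM.setIntegral_cell_congr (hg i) fun r y => r k * φ y]
    simp only [inner_single_right]

end IsSquareMesh

/-! ### Jumps across interior edges -/

theorem cross_smul (r : ℝ) (v w : Plane) : cross v (r • w) = r * cross v w := by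
  simp only [cross, PiLp.smul_apply, smul_eq_mul]; ring

theorem cross_neg (v w : Plane) : cross v (-w) = -cross v w := by
  simp only [cross, PiLp.neg_apply]; ring

theorem exists_cross_single_ne_zero {w : Plane} (hw : w ≠ 0) :
    ∃ k : Fin 2, cross (EuclideanSpace.single k 1) w ≠ 0 := by
  by_contra! h
  have h0 := h 0
  have h1 := h 1
  simp [cross] at h0 h1
  exact hw (plane_ext (by simpa using h1) (by simpa using h0))

namespace IsSquareMesh

variable {ι : Type*} {Ω : Set Plane} {z : ι → Fin 4 → Plane} (hM : IsSquareMesh Ω z)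
include hM

theorem edgeMean_neighbor {i j : ι} (hij : i ≠ j) {p q : Fin 4}
    (he : edge (z i) p = edge (z j) q) (F : Plane → ℝ) :
    edgeMean F (z j q) (z j (q + 1)) = edgeMean F (z i p) (z i (p + 1)) := by
  rcases hM.opposite hij he with ⟨h1, h2, -⟩ | ⟨h1, h2, -⟩
  · rw [h1, h2]
  · rw [h1, h2, edgeMean_comm]

theorem orientation_mul_cross {i j : ι} (hij : i ≠ j) {p q : Fin 4}
    (he : edge (z i) p = edge (z j) q) (v : Plane) :
    orientation (z j) * cross v (z j (q + 1) - z j q) =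
      -(orientation (z i) * cross v (z i (p + 1) - z i p)) := by
  rw [← cross_smul, hM.orientation_smul_tangent hij he, cross_neg, cross_smul]

/-- Allows a single interior edge to be isolated: all edges other than its two copies avoid its
inner points. -/
theorem eq_or_eq_of_mem_openSegment {i j k : ι} (hij : i ≠ j) {p q r : Fin 4}
    (he : edge (z i) p = edge (z j) q) {x : Plane} (hx : x ∈ openSegment ℝ (z i p) (z i (p + 1)))
    (hk : x ∈ edge (z k) r) : (k, r) = (i, p) ∨ (k, r) = (j, q) := by
  by_cases hki : i = k
  · subst hki
    left
    rw [(hM.square i).eq_of_mem_openSegment_of_mem_edge hx hk]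
  · right
    obtain ⟨s, hs, hinter⟩ := hM.exists_edge_eq hki hx ((hM.square k).edge_subset_cell r hk)
    have hjk := hM.eq_of_edge_eq hij hki he hs
    subst hjk
    have hsq := (hM.square j).edge_injective (hs.symm.trans he)
    subst hsq
    have h0 := (hM.square j).eq_of_mem_openSegment_of_mem_edge (p := s) (q := r) (y := x) ?_ hk
    · rw [h0]
    · rcases hM.opposite hij he with ⟨h1, h2, -⟩ | ⟨h1, h2, -⟩
      · rwa [h1, h2]
      · rw [h1, h2, openSegment_symm]; exact hx

theorem tangent_ne_zero (i : ι) (p : Fin 4) : z i (p + 1) - z i p ≠ 0 := by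
  intro h
  refine (hM.square i).vertex_notMem_openSegment p p ?_
  rw [sub_eq_zero.1 h, openSegment_same]; rfl

/-- The traces of a piecewise smooth function with a weak gradient agree on interior edges. -/
theorem trace_eq [Finite ι] {u : L2 Ω ℝ} {g : L2 Ω Plane} {α : ι → Fin 5 → ℝ}
    (hug : HasWeakGradient Ω Ω u g) (hu : ∀ i, EqOnCell Ω (z i) u (cellFun (z i) (α i)))
    {i j : ι} (hij : i ≠ j) {p q : Fin 4} (he : edge (z i) p = edge (z j) q) :
    ∀ y ∈ edge (z i) p, cellFun (z i) (α i) y = cellFun (z j) (α j) y := by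
  classical
  have := Fintype.ofFinite ι
  have hg : ∀ i, EqOnCell Ω (z i) g (cellGrad (z i) (α i)) := fun i =>
    (hug.mono (hM.interior_cell_subset i)).eqOnCell (hM.square i) hM.isOpen
      (hM.interior_cell_subset i) (hu i)
  set D : Plane → ℝ := fun y => cellFun (z i) (α i) y - cellFun (z j) (α j) y with hD
  have hDs : ContDiff ℝ ∞ D := (contDiff_cellFun _ _).sub (contDiff_cellFun _ _)
  -- The jump is continuous, so inner points of the edge suffice.
  suffices h : ∀ x ∈ openSegment ℝ (z i p) (z i (p + 1)), D x = 0 by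
    intro y hy
    have h1 : EqOn D 0 (closure (openSegment ℝ (z i p) (z i (p + 1)))) :=
      EqOn.closure (fun x hx => h x hx) hDs.continuous continuous_const
    exact sub_eq_zero.1 (h1 (segment_subset_closure_openSegment hy))
  intro x hx
  by_contra hne
  -- A neighbourhood of `x` in Ω that misses every edge not through `x`; a test function supported
  -- there sees only the two copies of the given edge.
  let U : Set Plane := Ω ∩ ⋂ a : {a : ι × Fin 4 // x ∉ edge (z a.1) a.2}, (edge (z a.1.1) a.1.2)ᶜ
  have hU : IsOpen U := hM.isOpen.inter
    (isOpen_iInter_of_finite fun a => (isClosed_edge (z a.1.1) a.1.2).isOpen_compl)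
  have hxU : x ∈ U := ⟨hM.openSegment_subset hij he hx, mem_iInter.2 fun a => a.2⟩
  obtain ⟨f, hfs, hfc, hfd, hf01, hfx⟩ := exists_contDiff_tsupport_subset (n := ⊤) (hU.mem_nhds hxU)
  -- The test function is a bump times the jump, so the surviving edge term is a multiple of the
  -- integral of `f * D ^ 2`, which is positive if `D x ≠ 0`.
  set φ : Plane → ℝ := fun y => f y * D y with hφdef
  have hφ : ContDiff ℝ ∞ φ := hfd.mul hDs
  have hφc : HasCompactSupport φ := hfc.mul_right
  have hφs : tsupport φ ⊆ U := (tsupport_mul_subset_left).trans hfs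
  -- A coordinate direction transversal to the edge, so that the jump enters with a nonzero factor.
  obtain ⟨k, hk⟩ := exists_cross_single_ne_zero (hM.tangent_ne_zero i p)
  have hsum := hM.setIntegral_by_parts hu hg hφ hφc k
  rw [hug φ hφ hφc (hφs.trans inter_subset_left) k, neg_add_cancel, ← Fintype.sum_prod_type',
    Fintype.sum_eq_add (i, p) (j, q) (fun h => hij (congrArg Prod.fst h))] at hsum
  · rw [hM.edgeMean_neighbor hij he, ← mul_assoc, ← mul_assoc, hM.orientation_mul_cross hij he,
      neg_mul, ← sub_eq_add_neg, ← mul_sub] at hsum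
    have ho : orientation (z i) ≠ 0 := by
      intro h
      have := (hM.square i).orientation_sq
      rw [h] at this
      norm_num at this
    have h1 := (mul_eq_zero.1 hsum.symm).resolve_left (mul_ne_zero ho hk)
    have hl : Continuous fun t : ℝ => (AffineMap.lineMap (z i p) (z i (p + 1)) t : Plane) :=
      AffineMap.lineMap_continuous
    have hi : ∀ k, IntervalIntegrable (fun t : ℝ =>
        (fun y => cellFun (z k) (α k) y * φ y) (AffineMap.lineMap (z i p) (z i (p + 1)) t))
        volume 0 1 := fun k =>
      Continuous.intervalIntegrable
        (((continuous_cellFun (z k) (α k)).mul hφ.continuous).comp hl) _ _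
    unfold edgeMean at h1
    rw [← intervalIntegral.integral_sub (hi i) (hi j)] at h1
    have hpos : ∀ t : ℝ, (cellFun (z i) (α i) (AffineMap.lineMap (z i p) (z i (p + 1)) t) *
        φ (AffineMap.lineMap (z i p) (z i (p + 1)) t) -
        cellFun (z j) (α j) (AffineMap.lineMap (z i p) (z i (p + 1)) t) *
        φ (AffineMap.lineMap (z i p) (z i (p + 1)) t)) =
        f (AffineMap.lineMap (z i p) (z i (p + 1)) t) *
          D (AffineMap.lineMap (z i p) (z i (p + 1)) t) ^ 2 := by
      intro t
      simp only [hφdef, hD]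
      ring
    simp only [hpos] at h1
    refine (intervalIntegral.integral_pos zero_lt_one ?_ ?_ ?_).ne' h1
    · exact ((hfd.continuous.comp hl).mul ((hDs.continuous.comp hl).pow 2)).continuousOn
    · intro t _
      exact mul_nonneg (hf01 ⟨_, rfl⟩).1 (sq_nonneg _)
    · rw [openSegment_eq_image_lineMap] at hx
      obtain ⟨t, ht, rfl⟩ := hx
      refine ⟨t, Ioo_subset_Icc_self ht, ?_⟩
      rw [hfx, one_mul]
      positivity
  · rintro ⟨k', r⟩ ⟨h1, h2⟩
    have hxe : x ∉ edge (z k') r := fun h => by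
      rcases hM.eq_or_eq_of_mem_openSegment hij he hx h with h | h
      · exact h1 h
      · exact h2 h
    have : edgeMean (fun y => cellFun (z k') (α k') y * φ y) (z k' r) (z k' (r + 1)) = 0 := by
      refine edgeMean_eq_zero fun y hy => ?_
      have : φ y = 0 := image_eq_zero_of_notMem_tsupport fun h =>
        (mem_iInter.1 (hφs h).2 ⟨(k', r), hxe⟩) hy
      rw [this, mul_zero]
    change orientation (z k') * (_ * edgeMean _ (z k' r) (z k' (r + 1))) = 0
    rw [this, mul_zero, mul_zero]

/-- A piecewise smooth function that is continuous in `Ω` has a weak gradient. -/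
theorem hasWeakGradient_of_continuous [Finite ι] {u : L2 Ω ℝ} {g : L2 Ω Plane}
    {α : ι → Fin 5 → ℝ} (hu : ∀ i, EqOnCell Ω (z i) u (cellFun (z i) (α i)))
    (hg : ∀ i, EqOnCell Ω (z i) g (cellGrad (z i) (α i)))
    (hc : ∀ i j, ∀ y ∈ Ω, y ∈ cell (z i) → y ∈ cell (z j) →
      cellFun (z i) (α i) y = cellFun (z j) (α j) y) : HasWeakGradient Ω Ω u g := by
  have := Fintype.ofFinite ι
  intro φ hφ hφc hs k
  rw [← add_eq_zero_iff_eq_neg, hM.setIntegral_by_parts hu hg hφ hφc k]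
  have h0 : ∀ y, y ∉ Ω → φ y = 0 := fun y hy => image_eq_zero_of_notMem_tsupport fun h => hy (hs h)
  refine hM.sum_eq_zero _ ?_ ?_
  · intro i p hf
    rw [edgeMean_eq_zero, mul_zero, mul_zero]
    intro y hy
    have := hf hy
    rw [hM.isOpen.frontier_eq] at this
    rw [h0 y this.2, mul_zero]
  · intro i j p q hij he
    have h1 : edgeMean (fun y => cellFun (z j) (α j) y * φ y) (z i p) (z i (p + 1)) =
        edgeMean (fun y => cellFun (z i) (α i) y * φ y) (z i p) (z i (p + 1)) := by
      refine edgeMean_congr fun y hy => ?_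
      -- The end points of the edge may lie outside Ω, where agreement is not assumed but φ
      -- vanishes.
      by_cases hyΩ : y ∈ Ω
      · rw [hc i j y hyΩ ((hM.square i).edge_subset_cell p hy)
          ((hM.square j).edge_subset_cell q (he ▸ hy))]
      · rw [h0 y hyΩ, mul_zero, mul_zero]
    rw [hM.edgeMean_neighbor hij he, h1, ← mul_assoc, ← mul_assoc, hM.orientation_mul_cross hij he]
    ring

/-- The discrete orthogonality of nonconforming gradients and conforming curls. -/
theorem sum_setIntegral_inner_eq_zero [Fintype ι] {α β : ι → Fin 5 → ℝ} (hβ : ∀ i, β i 4 = 0)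
    (hint : ∀ i j p q, i ≠ j → edge (z i) p = edge (z j) q →
      edgeMean (cellFun (z i) (α i)) (z i p) (z i (p + 1)) =
        edgeMean (cellFun (z j) (α j)) (z j q) (z j (q + 1)))
    (hbd : ∀ i p, edge (z i) p ⊆ frontier Ω →
      edgeMean (cellFun (z i) (α i)) (z i p) (z i (p + 1)) = 0)
    (htr : ∀ i j p q, i ≠ j → edge (z i) p = edge (z j) q →
      ∀ y ∈ edge (z i) p, cellFun (z i) (β i) y = cellFun (z j) (β j) y) :
    ∑ i, ∫ y in cell (z i), inner ℝ (cellGrad (z i) (α i) y) (turn (cellGrad (z i) (β i) y)) = 0 := by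
  have h : ∀ i, ∫ y in cell (z i), inner ℝ (cellGrad (z i) (α i) y) (turn (cellGrad (z i) (β i) y)) =
      ∑ p, orientation (z i) * ((cellFun (z i) (β i) (z i (p + 1)) - cellFun (z i) (β i) (z i p)) *
        edgeMean (cellFun (z i) (α i)) (z i p) (z i (p + 1))) := fun i => by
    rw [(hM.square i).setIntegral_inner_cellGrad_turn _ (hβ i), Finset.mul_sum]
  simp only [h]
  refine hM.sum_eq_zero _ ?_ ?_
  · intro i p hf
    rw [hbd i p hf, mul_zero, mul_zero]
  · intro i j p q hij he
    rw [← hint i j p q hij he]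
    have t0 := htr i j p q hij he _ (left_mem_segment ℝ (z i p) (z i (p + 1)))
    have t1 := htr i j p q hij he _ (right_mem_segment ℝ (z i p) (z i (p + 1)))
    rw [t0, t1]
    -- If both numberings run through the edge in the same direction, the orientations are opposite;
    -- otherwise the increment changes sign. The two contributions cancel in either case.
    rcases hM.opposite hij he with ⟨h1, h2, h3⟩ | ⟨h1, h2, h3⟩
    · rw [h1, h2, h3]; ring
    · rw [h1, h2, h3]; ring

end IsSquareMesh

/-! ### Coefficients of the discrete spaces -/

theorem pullbackEq_iff {F : Type*} [NormedAddCommGroup F] {Ω : Set Plane} {z : Fin 4 → Plane}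
    (hz : IsSquareCell z) {u : L2 Ω F} {q : Plane → F} :
    PullbackEq Ω z u q ↔ EqOnCell Ω z u fun y => q (chart z y) := by
  constructor
  · intro h
    filter_upwards [h] with y hy hyz
    exact hy _ (hz.mem_cell_iff.1 hyz) (hz.bilin_chart y)
  · intro h
    filter_upwards [h] with y hy x hx hxy
    rw [hy ⟨x, hx, hxy⟩, ← hxy, hz.chart_bilin]

theorem exists_quad_of_mem_refQ_one {q : Plane → ℝ} (hq : q ∈ refQ 1) :
    ∃ α : Fin 5 → ℝ, α 4 = 0 ∧ q = quad α := by
  induction hq using Submodule.span_induction with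
  | mem q hq =>
    obtain ⟨f, g, hf, hg, rfl⟩ := hq
    obtain ⟨a, b, rfl⟩ := Polynomial.exists_eq_X_add_C_of_natDegree_le_one hf
    obtain ⟨c, d, rfl⟩ := Polynomial.exists_eq_X_add_C_of_natDegree_le_one hg
    refine ⟨![b * d, a * d, b * c, a * c, 0], rfl, ?_⟩
    funext x
    simp [quad]
    ring
  | zero => exact ⟨0, rfl, by funext x; simp [quad]⟩
  | add q r _ _ hq hr =>
    obtain ⟨α, hα, rfl⟩ := hq
    obtain ⟨β, hβ, rfl⟩ := hr
    exact ⟨α + β, by simp [hα, hβ], by funext x; simp [quad]; ring⟩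
  | smul c q _ hq =>
    obtain ⟨α, hα, rfl⟩ := hq
    exact ⟨c • α, by simp [hα], by funext x; simp [quad]; ring⟩

theorem quad_mem_refQ_one {α : Fin 5 → ℝ} (hα : α 4 = 0) : quad α ∈ refQ 1 := by
  have h : ∀ a b c d : ℝ, (fun x : Plane => (a + b * x 0) * (c + d * x 1)) ∈ refQ 1 := by
    intro a b c d
    refine Submodule.subset_span ⟨Polynomial.C b * Polynomial.X + Polynomial.C a,
      Polynomial.C d * Polynomial.X + Polynomial.C c, Polynomial.natDegree_linear_le,
      Polynomial.natDegree_linear_le, ?_⟩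
    funext x
    simp
    ring
  -- Splits the bilinear polynomial as (α₀ + α₁x) · 1 + (α₂ + α₃x) · y.
  have h2 := Submodule.add_mem _ (h (α 0) (α 1) 1 0) (h (α 2) (α 3) 0 1)
  convert h2 using 1
  funext x
  simp [quad, hα]
  ring

theorem mem_refQ_zero {q : Plane → ℝ} : q ∈ refQ 0 ↔ ∃ c : ℝ, q = fun _ => c := by
  constructor
  · intro hq
    induction hq using Submodule.span_induction with
    | mem q hq =>
      obtain ⟨f, g, hf, hg, rfl⟩ := hq
      rw [Polynomial.eq_C_of_natDegree_le_zero hf, Polynomial.eq_C_of_natDegree_le_zero hg]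
      exact ⟨f.coeff 0 * g.coeff 0, by simp⟩
    | zero => exact ⟨0, rfl⟩
    | add q r _ _ hq hr =>
      obtain ⟨a, rfl⟩ := hq
      obtain ⟨b, rfl⟩ := hr
      exact ⟨a + b, rfl⟩
    | smul c q _ hq =>
      obtain ⟨a, rfl⟩ := hq
      exact ⟨c * a, rfl⟩
  · rintro ⟨c, rfl⟩
    exact Submodule.subset_span ⟨Polynomial.C c, 1, by simp, by simp, by simp⟩

theorem mem_refQrot {q : Plane → ℝ} :
    q ∈ refQrot ↔ ∃ α : Fin 5 → ℝ, α 3 = 0 ∧ q = quad α := by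
  rw [refQrot]
  simp only [Submodule.mem_span_insert, Submodule.mem_span_singleton]
  constructor
  · rintro ⟨a, _, ⟨b, _, ⟨c, _, ⟨d, rfl⟩, rfl⟩, rfl⟩, rfl⟩
    refine ⟨![a, b, c, 0, d], rfl, ?_⟩
    funext x
    simp [quad]
    ring
  · rintro ⟨α, hα, rfl⟩
    refine ⟨α 0, _, ⟨α 1, _, ⟨α 2, _, ⟨α 4, rfl⟩, rfl⟩, rfl⟩, ?_⟩
    funext x
    simp [quad, hα]
    ring

theorem mem_refX_one {ρ : Plane → Plane} :
    ρ ∈ refX 1 ↔ ∃ a b c : ℝ, ∀ x, ρ x = !₂[-(a * x 0) + b, a * x 1 + c] := by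
  constructor
  · rintro ⟨a, b, hb, c, hc, d, hd, e, he, h⟩
    obtain ⟨d, rfl⟩ := mem_refQ_zero.1 hd
    obtain ⟨e, rfl⟩ := mem_refQ_zero.1 he
    -- For k = 1 the degree bound is `1 - 1 = 0`, and only the zero polynomial has degree less than
    -- 0.
    have hb : b = 0 := by simpa [Polynomial.mem_degreeLT] using hb
    have hc : c = 0 := by simpa [Polynomial.mem_degreeLT] using hc
    refine ⟨a, d, e, fun x => ?_⟩
    rw [h]
    refine plane_ext ?_ ?_ <;> simp [hb, hc]
  · rintro ⟨a, b, c, h⟩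
    refine ⟨a, 0, zero_mem _, 0, zero_mem _, _, mem_refQ_zero.2 ⟨b, rfl⟩, _,
      mem_refQ_zero.2 ⟨c, rfl⟩, fun x => ?_⟩
    rw [h]
    refine plane_ext ?_ ?_ <;> simp

namespace IsSquareCell

variable {z : Fin 4 → Plane} (hz : IsSquareCell z)
include hz

theorem bilinJacobian_eq (x : Plane) : bilinJacobian z x =
    !![z 1 0 - z 0 0, z 3 0 - z 0 0; z 1 1 - z 0 1, z 3 1 - z 0 1] := by
  have h : HasFDerivAt (bilin z)
      ((EuclideanSpace.proj (𝕜 := ℝ) 0 : Plane →L[ℝ] ℝ).smulRight (z 1 - z 0) +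
        (EuclideanSpace.proj (𝕜 := ℝ) 1 : Plane →L[ℝ] ℝ).smulRight (z 3 - z 0)) x := by
    rw [show bilin z = fun x => z 0 + ((EuclideanSpace.proj (𝕜 := ℝ) 0 : Plane →L[ℝ] ℝ).smulRight
        (z 1 - z 0) + (EuclideanSpace.proj (𝕜 := ℝ) 1 : Plane →L[ℝ] ℝ).smulRight (z 3 - z 0)) x from
      funext fun x => hz.bilin_eq x]
    exact (ContinuousLinearMap.hasFDerivAt _).const_add _
  ext k l
  rw [bilinJacobian, Matrix.of_apply, h.fderiv]
  fin_cases k <;> fin_cases l <;> simp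

/-- Conjugating the inverse transpose of a 2 × 2 matrix by the quarter turn gives the matrix divided
by its determinant. Thus `cellMatrix` is Dψ / det Dψ, the Piola transform, and the inverse of the
orientation is the orientation. -/
theorem cellMatrix_apply (x v : Plane) : Matrix.toEuclideanLin (cellMatrix z x) v =
    ((sideSq z)⁻¹ * orientation z) • (v 0 • (z 1 - z 0) + v 1 • (z 3 - z 0)) := by
  have hN := hz.sideSq_pos.ne'
  have hoi : (orientation z)⁻¹ = orientation z := by
    exact inv_eq_of_mul_eq_one_left (by rw [← sq, hz.orientation_sq])
  have hinv : (bilinJacobian z x)⁻¹ = ((sideSq z)⁻¹ * orientation z) •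
      !![z 3 1 - z 0 1, -(z 3 0 - z 0 0); -(z 1 1 - z 0 1), z 1 0 - z 0 0] := by
    rw [hz.bilinJacobian_eq, Matrix.inv_def, Matrix.adjugate_fin_two_of, Matrix.det_fin_two_of,
      Ring.inverse_eq_inv', mul_comm (z 3 0 - z 0 0), ← hz.orientation_mul_sideSq, mul_inv, hoi,
      mul_comm]
  rw [cellMatrix, hinv]
  refine plane_ext ?_ ?_ <;>
  · simp [Matrix.toLpLin_apply, Matrix.mul_apply, dotProduct, Fin.sum_univ_two,
      Matrix.vecMul]
    ring

/-- The Curl of a function pushed forward by ψ is the Piola transform of its reference Curl, here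
(β₂ + β₃x, -(β₁ + β₃y)). -/
theorem turn_cellGrad (β : Fin 5 → ℝ) (hβ : β 4 = 0) (y : Plane) : turn (cellGrad z β y) =
    ((sideSq z)⁻¹ * orientation z) • ((β 2 + β 3 * chart z y 0) • (z 1 - z 0) -
      (β 1 + β 3 * chart z y 1) • (z 3 - z 0)) := by
  have ho := hz.orientation_sq
  refine plane_ext ?_ ?_
  · simp [turn, cellGrad, hβ, hz.three_zero, hz.three_one]
    linear_combination (-(sideSq z)⁻¹ * (β 1 + β 3 * chart z y 1) * (z 1 1 - z 0 1)) * ho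
  · simp [turn, cellGrad, hβ, hz.three_zero, hz.three_one]
    linear_combination ((sideSq z)⁻¹ * (β 1 + β 3 * chart z y 1) * (z 1 0 - z 0 0)) * ho

/-- The gradient of a function in `Q^rot` is the curl of a function in `Q_1`. -/
theorem exists_turn_cellGrad_eq {α : Fin 5 → ℝ} (hα : α 3 = 0) :
    ∃ β : Fin 5 → ℝ, β 4 = 0 ∧ ∀ y, cellGrad z α y = turn (cellGrad z β y) := by
  have ho := hz.orientation_sq
  -- The harmonic conjugate of α₁x + α₂y + α₄(x² - y²) is -α₂x + α₁y + 2α₄xy; a chart that reverses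
  -- orientation changes its sign.
  refine ⟨![0, -(orientation z * α 2), orientation z * α 1, orientation z * (2 * α 4), 0], rfl,
    fun y => ?_⟩
  rw [hz.turn_cellGrad _ rfl]
  refine plane_ext ?_ ?_
  · simp [cellGrad, hα, hz.three_zero]
    ring_nf
    rw [show orientation z ^ 3 = orientation z * orientation z ^ 2 by ring, ho]
    ring
  · simp [cellGrad, hα, hz.three_one]
    ring_nf
    rw [show orientation z ^ 3 = orientation z * orientation z ^ 2 by ring, ho]
    ring

end IsSquareCell

/-- The reference field (-ax + b, ay + c) is the Curl of -cx + by - axy, and the Piola transform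
preserves Curls. Hence X_1 consists of the piecewise Curls of Q_1 functions, with no condition
between cells. -/
theorem mem_spaceX_one_iff {ι : Type*} {Ω : Set Plane} {z : ι → Fin 4 → Plane}
    (hz : ∀ i, IsSquareCell (z i)) {τ : L2 Ω Plane} : τ ∈ spaceX 1 Ω z ↔
      ∀ i, ∃ β : Fin 5 → ℝ, β 4 = 0 ∧
        EqOnCell Ω (z i) τ fun y => turn (cellGrad (z i) β y) := by
  refine forall_congr' fun i => ?_
  constructor
  · rintro ⟨ρ, hρ, h⟩
    obtain ⟨a, b, c, hρ⟩ := mem_refX_one.1 hρ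
    refine ⟨![0, -c, b, -a, 0], rfl, ((pullbackEq_iff (hz i)).1 h).congr fun y _ => ?_⟩
    rw [(hz i).cellMatrix_apply, hρ, (hz i).turn_cellGrad _ rfl]
    congr 1
    simp
    module
  · rintro ⟨β, hβ, h⟩
    refine ⟨fun x => !₂[-((-β 3) * x 0) + β 2, (-β 3) * x 1 + (-β 1)],
      mem_refX_one.2 ⟨-β 3, β 2, -β 1, fun x => rfl⟩,
      (pullbackEq_iff (hz i)).2 (h.congr fun y _ => ?_)⟩
    rw [(hz i).cellMatrix_apply, (hz i).turn_cellGrad _ hβ]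
    congr 1
    simp
    module

theorem mem_spaceVQ_one_iff {ι : Type*} {Ω : Set Plane} {z : ι → Fin 4 → Plane}
    (hz : ∀ i, IsSquareCell (z i)) {u : L2 Ω ℝ} : u ∈ spaceVQ 1 Ω z ↔ u ∈ spaceY Ω ∧
      ∀ i, ∃ β : Fin 5 → ℝ, β 4 = 0 ∧ EqOnCell Ω (z i) u (cellFun (z i) β) := by
  refine and_congr_right fun _ => forall_congr' fun i => ?_
  constructor
  · rintro ⟨q, hq, h⟩
    obtain ⟨β, hβ, rfl⟩ := exists_quad_of_mem_refQ_one hq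
    exact ⟨β, hβ, (pullbackEq_iff (hz i)).1 h⟩
  · rintro ⟨β, hβ, h⟩
    exact ⟨quad β, quad_mem_refQ_one hβ, (pullbackEq_iff (hz i)).2 h⟩

theorem segmentIntegral_eq (v : Plane → ℝ) (a b : Plane) :
    segmentIntegral v a b = ‖b - a‖ * edgeMean v a b := rfl

/-- The edge conditions of the rotated nonconforming space, in terms of local coefficients. -/
structure IsNCCoeff {ι : Type*} (Ω : Set Plane) (z : ι → Fin 4 → Plane) (α : ι → Fin 5 → ℝ) :
    Prop where
  coeff : ∀ i, α i 3 = 0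
  interior : ∀ i j p q, i ≠ j → edge (z i) p = edge (z j) q →
    edgeMean (cellFun (z i) (α i)) (z i p) (z i (p + 1)) =
      edgeMean (cellFun (z j) (α j)) (z j q) (z j (q + 1))
  boundary : ∀ i p, edge (z i) p ⊆ frontier Ω →
    edgeMean (cellFun (z i) (α i)) (z i p) (z i (p + 1)) = 0

/-- Edge integrals may be replaced by means because the length is nonzero and the same from both
sides. The proviso on boundary edges disappears since a shared edge is never contained in the
boundary. -/
theorem IsSquareMesh.mem_spaceNC_iff {ι : Type*} {Ω : Set Plane} {z : ι → Fin 4 → Plane}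
    (hM : IsSquareMesh Ω z) {v : L2 Ω ℝ} : v ∈ spaceNC Ω z ↔
      ∃ α, IsNCCoeff Ω z α ∧ ∀ i, EqOnCell Ω (z i) v (cellFun (z i) (α i)) := by
  have hpos : ∀ i p, ‖z i (p + 1) - z i p‖ ≠ 0 := fun i p => norm_ne_zero_iff.2 (hM.tangent_ne_zero i p)
  have hnorm : ∀ i j p q, i ≠ j → edge (z i) p = edge (z j) q →
      ‖z j (q + 1) - z j q‖ = ‖z i (p + 1) - z i p‖ := by
    intro i j p q hij he
    rcases hM.opposite hij he with ⟨h1, h2, -⟩ | ⟨h1, h2, -⟩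
    · rw [h1, h2]
    · rw [h1, h2, norm_sub_rev]
  constructor
  · rintro ⟨w, ⟨h1, h2, h3⟩, h4⟩
    have h5 : ∀ i, ∃ α : Fin 5 → ℝ, α 3 = 0 ∧ ∀ y ∈ cell (z i), w i y = cellFun (z i) α y := by
      intro i
      obtain ⟨q, hq, h⟩ := (h1 i).2
      obtain ⟨α, hα, rfl⟩ := mem_refQrot.1 hq
      refine ⟨α, hα, fun y hy => ?_⟩
      have := h _ ((hM.square i).mem_cell_iff.1 hy)
      rwa [(hM.square i).bilin_chart] at this
    choose α hα hw using h5
    have hmean : ∀ i p, edgeMean (w i) (z i p) (z i (p + 1)) =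
        edgeMean (cellFun (z i) (α i)) (z i p) (z i (p + 1)) := fun i p =>
      edgeMean_congr fun y hy => hw i y ((hM.square i).edge_subset_cell p hy)
    refine ⟨α, ⟨hα, fun i j p q hij he => ?_, fun i p hf => ?_⟩, fun i => ?_⟩
    · have := h2 i j p q hij he (hM.not_subset_frontier hij he)
      rw [segmentIntegral_eq, segmentIntegral_eq, hnorm i j p q hij he, hmean, hmean] at this
      exact mul_left_cancel₀ (hpos i p) this
    · have := h3 i p hf
      rw [segmentIntegral_eq, hmean] at this
      exact (mul_eq_zero.1 this).resolve_left (hpos i p)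
    · filter_upwards [h4 i] with y hy hyz
      rw [hy hyz, hw i y hyz]
  · rintro ⟨α, hα, h⟩
    refine ⟨fun i => cellFun (z i) (α i), ⟨fun i => ⟨continuous_cellFun _ _, quad (α i),
      mem_refQrot.2 ⟨α i, hα.coeff i, rfl⟩, fun x _ => ?_⟩, fun i j p q hij he _ => ?_,
      fun i p hf => ?_⟩, h⟩
    · change quad (α i) (chart (z i) (bilin (z i) x)) = _
      rw [(hM.square i).chart_bilin]
    · rw [segmentIntegral_eq, segmentIntegral_eq, hnorm i j p q hij he,
        hα.interior i j p q hij he]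
    · rw [segmentIntegral_eq, hα.boundary i p hf, mul_zero]

/-! ### Gluing local potentials on a simply connected space -/

open Topology Filter in
-- The differences f_x - f_x' are locally constant on overlaps, so they are continuous transition
-- maps of a bundle with discrete fibre `A`, that is, of a covering space. Simple connectedness
-- provides a global section, and reading it in the local trivialisations gives β with β - f_x
-- locally constant on `U x`.
theorem exists_potential_of_isSimplyConnected {X A : Type*} [TopologicalSpace X]
    [SimplyConnectedSpace X] [LocallyPathConnectedSpace X] [AddCommGroup A]
    (U : X → Set X) (hUo : ∀ x, IsOpen (U x)) (hUx : ∀ x, x ∈ U x) (f : X → X → A)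
    (hf : ∀ x x', ∀ y ∈ U x ∩ U x', ∀ᶠ w in 𝓝 y, f x w - f x' w = f x y - f x' y) :
    ∃ β : X → A, ∀ x, ∀ y ∈ U x, ∀ᶠ w in 𝓝 y, β w - β y = f x w - f x y := by
  let _ : TopologicalSpace A := ⊥
  have _ : DiscreteTopology A := ⟨rfl⟩
  let Z : FiberBundleCore X X A :=
    { baseSet := U
      isOpen_baseSet := hUo
      indexAt := id
      mem_baseSet_at := hUx
      coordChange := fun i j y v => v + (f i y - f j y)
      coordChange_self := fun i y _ v => by simp
      continuousOn_coordChange := by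
        intro i j p hp
        refine ContinuousAt.continuousWithinAt ?_
        have h1 : ∀ᶠ q : X × A in 𝓝 p, f i q.1 - f j q.1 = f i p.1 - f j p.1 :=
          continuousAt_fst.eventually (hf i j p.1 hp.1)
        have h2 : ContinuousAt (fun q : X × A => q.2 + (f i p.1 - f j p.1)) p := by fun_prop
        refine h2.congr ?_
        filter_upwards [h1] with q hq
        rw [hq]
      coordChange_comp := fun i j k y _ v => by abel }
  obtain ⟨a₀⟩ : Nonempty X := inferInstance
  have cov : IsCoveringMap Z.proj := FiberBundle.isCoveringMap (F := A) (E := Z.Fiber)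
  -- The section is the lift of the identity map through an arbitrary point of the fibre over `a₀`.
  obtain ⟨s, ⟨-, hs⟩, -⟩ := cov.existsUnique_continuousMap_lifts (ContinuousMap.id X) a₀
    (⟨a₀, (0 : A)⟩ : Z.TotalSpace) rfl
  have hs' : ∀ y, (s y).1 = y := fun y => congrFun hs y
  have key : ∀ x, ∀ y ∈ U x, ∀ᶠ w in 𝓝 y,
      ((Z.localTriv x) (s w)).2 = ((Z.localTriv x) (s y)).2 := by
    intro x y hy
    have hmem : s y ∈ (Z.localTriv x).source := by
      rw [Z.mem_localTriv_source, hs']; exact hy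
    have hc : ContinuousAt (fun w => ((Z.localTriv x) (s w)).2) y :=
      continuousAt_snd.comp (((Z.localTriv x).continuousAt hmem).comp s.continuous.continuousAt)
    have h1 := hc.eventually (p := fun a => a = ((Z.localTriv x) (s y)).2)
      (by rw [nhds_discrete]; exact eventually_pure.2 rfl)
    exact h1
  let σ : X → A := fun w => (s w).2
  -- The fibre over `w` is written in the trivialisation of index `w`; passing to index `x` adds
  -- f_w(w) - f_x(w). This suggests `σ w + f w w` as the potential.
  have hval : ∀ x w, ((Z.localTriv x) (s w)).2 = σ w + (f w w - f x w) := by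
    intro x w
    rw [Z.localTriv_apply]
    change σ w + (f (s w).1 (s w).1 - f x (s w).1) = _
    rw [hs']
  refine ⟨fun w => σ w + f w w, fun x y hy => ?_⟩
  filter_upwards [key x y hy] with w hw
  rw [hval, hval] at hw
  have h1 : σ w + f w w = (σ y + (f y y - f x y)) + f x w := by rw [← hw]; abel
  change σ w + f w w - (σ y + f y y) = _
  rw [h1]; abel

/-! ### Inclusions and orthogonality -/

theorem cellGrad_add (z : Fin 4 → Plane) (α β : Fin 5 → ℝ) (y : Plane) :
    cellGrad z (α + β) y = cellGrad z α y + cellGrad z β y := by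
  simp only [cellGrad, Pi.add_apply]; module

theorem cellGrad_smul (z : Fin 4 → Plane) (r : ℝ) (α : Fin 5 → ℝ) (y : Plane) :
    cellGrad z (r • α) y = r • cellGrad z α y := by
  simp only [cellGrad, Pi.smul_apply, smul_eq_mul]; module

theorem cellGrad_add_const (z : Fin 4 → Plane) (α : Fin 5 → ℝ) (r : ℝ) (y : Plane) :
    cellGrad z (α + ![r, 0, 0, 0, 0]) y = cellGrad z α y := by
  simp [cellGrad]

theorem turn_add (v w : Plane) : turn (v + w) = turn v + turn w := by
  refine plane_ext ?_ ?_ <;> simp [turn]; ring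

theorem turn_smul (r : ℝ) (v : Plane) : turn (r • v) = r • turn v := by
  refine plane_ext ?_ ?_ <;> simp [turn]

theorem EqOnCell.add {E : Type*} [NormedAddCommGroup E] {Ω : Set Plane} {z : Fin 4 → Plane}
    {u v : L2 Ω E} {F G : Plane → E} (h : EqOnCell Ω z u F) (h' : EqOnCell Ω z v G) :
    EqOnCell Ω z (u + v) (fun y => F y + G y) := by
  filter_upwards [h, h', Lp.coeFn_add u v] with y hy hy' hs hyz
  rw [hs, Pi.add_apply, hy hyz, hy' hyz]

theorem EqOnCell.smul {E : Type*} [NormedAddCommGroup E] [NormedSpace ℝ E] {Ω : Set Plane}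
    {z : Fin 4 → Plane} {u : L2 Ω E} {F : Plane → E} (r : ℝ) (h : EqOnCell Ω z u F) :
    EqOnCell Ω z (r • u) (fun y => r • F y) := by
  filter_upwards [h, Lp.coeFn_smul r u] with y hy hs hyz
  rw [hs, Pi.smul_apply, hy hyz]

namespace IsSquareMesh

variable {ι : Type*} {Ω : Set Plane} {z : ι → Fin 4 → Plane} (hM : IsSquareMesh Ω z)
include hM

theorem exists_coeff_of_mem_gradNC {g : L2 Ω Plane} (hg : g ∈ gradNC Ω z) :
    ∃ α, IsNCCoeff Ω z α ∧ ∀ i, EqOnCell Ω (z i) g (cellGrad (z i) (α i)) := by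
  obtain ⟨v, hv, hvg⟩ := hg
  obtain ⟨α, hα, h⟩ := hM.mem_spaceNC_iff.1 hv
  exact ⟨α, hα, fun i => (hvg i).eqOnCell (hM.square i) hM.isOpen (hM.interior_cell_subset i) (h i)⟩

theorem mem_gradNC [Finite ι] {g : L2 Ω Plane} {α : ι → Fin 5 → ℝ} (hα : IsNCCoeff Ω z α)
    (hg : ∀ i, EqOnCell Ω (z i) g (cellGrad (z i) (α i))) : g ∈ gradNC Ω z := by
  obtain ⟨v, hv⟩ := hM.exists_piecewise (fun i => cellFun (z i) (α i))
    fun i => continuous_cellFun _ _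
  exact ⟨v, hM.mem_spaceNC_iff.2 ⟨α, hα, hv⟩, fun i =>
    (hv i).hasWeakGradient (hM.square i) hM.isOpen (hM.interior_cell_subset i) (hg i)⟩

theorem exists_coeff_of_mem_curlVQ [Finite ι] {c : L2 Ω Plane} (hc : c ∈ curlVQ 1 Ω z) :
    ∃ β : ι → Fin 5 → ℝ, (∀ i, β i 4 = 0) ∧
      (∀ i, EqOnCell Ω (z i) c fun y => turn (cellGrad (z i) (β i) y)) ∧
      ∀ i j p q, i ≠ j → edge (z i) p = edge (z j) q →
        ∀ y ∈ edge (z i) p, cellFun (z i) (β i) y = cellFun (z j) (β j) y := by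
  obtain ⟨u, hu, g, hug, hcg⟩ := hc
  obtain ⟨-, h⟩ := (mem_spaceVQ_one_iff hM.square).1 hu
  choose β hβ hu using h
  refine ⟨β, hβ, fun i => ?_, fun i j p q hij he => hM.trace_eq hug hu hij he⟩
  have hg := (hug.mono (hM.interior_cell_subset i)).eqOnCell (hM.square i) hM.isOpen
    (hM.interior_cell_subset i) (hu i)
  filter_upwards [hg, hcg] with y h1 h2 hy
  rw [h2, ← h1 hy]
  rfl

theorem gradNC_le_spaceX : gradNC Ω z ≤ spaceX 1 Ω z := by
  intro g hg
  obtain ⟨α, hα, h⟩ := hM.exists_coeff_of_mem_gradNC hg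
  refine (mem_spaceX_one_iff hM.square).2 fun i => ?_
  obtain ⟨β, hβ, hαβ⟩ := (hM.square i).exists_turn_cellGrad_eq (hα.coeff i)
  exact ⟨β, hβ, (h i).congr fun y _ => hαβ y⟩

theorem curlVQ_le_spaceX [Finite ι] : curlVQ 1 Ω z ≤ spaceX 1 Ω z := by
  intro c hc
  obtain ⟨β, hβ, h, -⟩ := hM.exists_coeff_of_mem_curlVQ hc
  exact (mem_spaceX_one_iff hM.square).2 fun i => ⟨β i, hβ i, h i⟩

theorem gradNC_isOrtho_curlVQ [Finite ι] : gradNC Ω z ⟂ curlVQ 1 Ω z := by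
  have := Fintype.ofFinite ι
  rw [Submodule.isOrtho_iff_inner_eq]
  intro g hg c hc
  obtain ⟨α, hα, h1⟩ := hM.exists_coeff_of_mem_gradNC hg
  obtain ⟨β, hβ, h2, h3⟩ := hM.exists_coeff_of_mem_curlVQ hc
  rw [hM.inner_eq_sum h1 h2]
  exact hM.sum_setIntegral_inner_eq_zero hβ hα.interior hα.boundary h3

/-- The space lies in the image of the finite-dimensional space of local coefficients. This makes
the orthogonal projection onto the gradients available. -/
theorem finiteDimensional_spaceX [Finite ι] : FiniteDimensional ℝ (spaceX 1 Ω z) := by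
  have := Fintype.ofFinite ι
  choose T hT using fun β : ι → Fin 5 → ℝ =>
    hM.exists_piecewise (fun i y => turn (cellGrad (z i) (β i) y))
      fun i => continuous_turn.comp (continuous_cellGrad _ _)
  let Λ : (ι → Fin 5 → ℝ) →ₗ[ℝ] L2 Ω Plane :=
    { toFun := T
      map_add' := fun β γ => hM.ae_eq_of_eqOnCell (hT _) fun i =>
        ((hT β i).add (hT γ i)).congr fun y _ => by
          rw [Pi.add_apply, cellGrad_add, turn_add]
      map_smul' := fun r β => hM.ae_eq_of_eqOnCell (hT _) fun i =>
        ((hT β i).smul r).congr fun y _ => by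
          rw [Pi.smul_apply, cellGrad_smul, turn_smul] }
  have hle : spaceX 1 Ω z ≤ LinearMap.range Λ := by
    intro τ hτ
    have h := (mem_spaceX_one_iff hM.square).1 hτ
    choose β _ hβ using h
    exact ⟨β, hM.ae_eq_of_eqOnCell (hT β) hβ⟩
  exact Submodule.finiteDimensional_of_le hle

end IsSquareMesh

/-! ### Fields orthogonal to the nonconforming gradients -/

/-- Unisolvence of Q^rot. The alternating sum m₁ + m₃ - m₀ - m₂ detects only x² - y² and equals
2α₄/3; the opposite edges then give α₁ = m₁ - m₃ - α₄ and α₂ = m₂ - m₀ + α₄, and α₀ follows from m₃.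
-/
theorem exists_edgeMean_quad_eq (m : Fin 4 → ℝ) : ∃ α : Fin 5 → ℝ, α 3 = 0 ∧
    ∀ p, edgeMean (quad α) (corner p) (corner (p + 1)) = m p := by
  refine ⟨![m 3 - (m 2 - m 0 + 3 / 2 * (m 1 + m 3 - m 0 - m 2)) / 2 +
    3 / 2 * (m 1 + m 3 - m 0 - m 2) / 3, m 1 - m 3 - 3 / 2 * (m 1 + m 3 - m 0 - m 2),
    m 2 - m 0 + 3 / 2 * (m 1 + m 3 - m 0 - m 2), 0, 3 / 2 * (m 1 + m 3 - m 0 - m 2)], rfl, ?_⟩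
  have f1 : (3 : Fin 4) + 1 = 0 := rfl
  have f2 : (2 : Fin 4) + 1 = 3 := rfl
  have f3 : (1 : Fin 4) + 1 = 2 := rfl
  have f4 : (0 : Fin 4) + 1 = 1 := rfl
  intro p
  fin_cases p
  · simp [edgeMean_quad_zero]; ring
  · simp [f3, edgeMean_quad_one]; ring
  · simp [f2, edgeMean_quad_two]; ring
  · simp [f1, edgeMean_quad_three]; ring

namespace IsSquareMesh

variable {ι : Type*} {Ω : Set Plane} {z : ι → Fin 4 → Plane} (hM : IsSquareMesh Ω z)
include hM

/-- The rotated nonconforming space contains functions with prescribed edge means. -/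
theorem exists_coeff_edgeMean_eq (m : ι → Fin 4 → ℝ)
    (hint : ∀ i j p q, i ≠ j → edge (z i) p = edge (z j) q → m i p = m j q)
    (hbd : ∀ i p, edge (z i) p ⊆ frontier Ω → m i p = 0) :
    ∃ α, IsNCCoeff Ω z α ∧
      ∀ i p, edgeMean (cellFun (z i) (α i)) (z i p) (z i (p + 1)) = m i p := by
  choose α hα hm using fun i => exists_edgeMean_quad_eq (m i)
  have h : ∀ i p, edgeMean (cellFun (z i) (α i)) (z i p) (z i (p + 1)) = m i p := fun i p => by
    rw [(hM.square i).edgeMean_cellFun, hm]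
  refine ⟨α, ⟨hα, fun i j p q hij he => ?_, fun i p hf => ?_⟩, h⟩
  · rw [h, h, hint i j p q hij he]
  · rw [h, hbd i p hf]

/-- If a field in `X₁` is orthogonal to the nonconforming gradients, its local potentials have
equal increments along interior edges. -/
theorem increment_eq_of_orthogonal [Finite ι] {τ : L2 Ω Plane} {β : ι → Fin 5 → ℝ}
    (hβ : ∀ i, β i 4 = 0) (hτ : ∀ i, EqOnCell Ω (z i) τ fun y => turn (cellGrad (z i) (β i) y))
    (horth : ∀ g ∈ gradNC Ω z, inner ℝ g τ = 0) {i j : ι} (hij : i ≠ j) {p q : Fin 4}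
    (he : edge (z i) p = edge (z j) q) :
    cellFun (z i) (β i) (z i (p + 1)) - cellFun (z i) (β i) (z i p) =
      cellFun (z j) (β j) (z i (p + 1)) - cellFun (z j) (β j) (z i p) := by
  classical
  have := Fintype.ofFinite ι
  -- The test function has mean 1 on the given edge, seen from either cell, and mean 0 on all other
  -- edges. The boundary condition holds because a shared edge is not in the boundary.
  obtain ⟨α, hα, hm⟩ := hM.exists_coeff_edgeMean_eq
    (fun k r => if edge (z k) r = edge (z i) p then 1 else 0)
    (fun k l r s _ h => by simp only [h])
    (fun k r hf => by
      refine if_neg fun h => hM.not_subset_frontier hij he ?_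
      rw [← h]
      exact hf)
  obtain ⟨g, hg⟩ := hM.exists_piecewise (fun i => cellGrad (z i) (α i))
    fun i => continuous_cellGrad _ _
  have h := horth g (hM.mem_gradNC hα hg)
  rw [hM.inner_eq_sum hg hτ] at h
  simp only [fun k => (hM.square k).setIntegral_inner_cellGrad_turn (α k) (hβ k), hm,
    Finset.mul_sum] at h
  rw [← Fintype.sum_prod_type', Fintype.sum_eq_add (i, p) (j, q)
    (fun h => hij (congrArg Prod.fst h))] at h
  · simp only [he, if_true, mul_one] at h
    have ho : orientation (z i) ≠ 0 := by
      intro h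
      have := (hM.square i).orientation_sq
      rw [h] at this
      norm_num at this
    refine mul_left_cancel₀ ho ?_
    rcases hM.opposite hij he with ⟨h1, h2, h3⟩ | ⟨h1, h2, h3⟩
    · rw [h1, h2, h3] at h
      linarith
    · rw [h1, h2, h3] at h
      linarith
  · rintro ⟨k, r⟩ ⟨h1, h2⟩
    have hne : ¬ edge (z k) r = edge (z i) p := by
      intro hk
      have hx := lineMap_half_mem_openSegment (z i p) (z i (p + 1))
      rcases hM.eq_or_eq_of_mem_openSegment hij he hx
        (hk ▸ openSegment_subset_edge (z i) p hx) with h | h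
      · exact h1 h
      · exact h2 h
    simp only [if_neg hne, mul_zero]

/-- Both local potentials are affine along a common edge, so equal increments between its end points
give equal increments between any two of its points. Cells that meet in one vertex impose no
condition. -/
theorem increment_eq [Finite ι] {τ : L2 Ω Plane} {β : ι → Fin 5 → ℝ}
    (hβ : ∀ i, β i 4 = 0) (hτ : ∀ i, EqOnCell Ω (z i) τ fun y => turn (cellGrad (z i) (β i) y))
    (horth : ∀ g ∈ gradNC Ω z, inner ℝ g τ = 0) (i j : ι) {x y : Plane} (hxi : x ∈ cell (z i))
    (hxj : x ∈ cell (z j)) (hyi : y ∈ cell (z i)) (hyj : y ∈ cell (z j)) :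
    cellFun (z i) (β i) y - cellFun (z i) (β i) x =
      cellFun (z j) (β j) y - cellFun (z j) (β j) x := by
  by_cases hij : i = j
  · subst hij; rfl
  have hx : x ∈ cell (z i) ∩ cell (z j) := ⟨hxi, hxj⟩
  have hy : y ∈ cell (z i) ∩ cell (z j) := ⟨hyi, hyj⟩
  rcases hM.partition.2 i j hij with h | ⟨p, q, -, h⟩ | ⟨p, q, he, h⟩
  · rw [h] at hx; exact hx.elim
  · rw [h] at hx hy
    rw [mem_singleton_iff.1 hx, mem_singleton_iff.1 hy, sub_self, sub_self]
  · have hinc := hM.increment_eq_of_orthogonal hβ hτ horth hij he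
    have key : ∀ w ∈ edge (z i) p, cellFun (z i) (β i) w - cellFun (z i) (β i) (z i p) =
        cellFun (z j) (β j) w - cellFun (z j) (β j) (z i p) := by
      intro w hw
      rw [edge, segment_eq_image_lineMap] at hw
      obtain ⟨t, -, rfl⟩ := hw
      rw [(hM.square i).cellFun_edge (hβ i)]
      have hj : cellFun (z j) (β j) (AffineMap.lineMap (z i p) (z i (p + 1)) t) =
          cellFun (z j) (β j) (z i p) +
            t * (cellFun (z j) (β j) (z i (p + 1)) - cellFun (z j) (β j) (z i p)) := by
        rcases hM.opposite hij he with ⟨h1, h2, -⟩ | ⟨h1, h2, -⟩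
        · rw [← h1, ← h2, (hM.square j).cellFun_edge (hβ j)]
        · rw [← h1, ← h2, ← AffineMap.lineMap_apply_one_sub, (hM.square j).cellFun_edge (hβ j)]
          ring
      rw [hj, ← hinc]
      ring
    rw [h] at hx hy
    linarith [key x hx, key y hy]

end IsSquareMesh

/-! ### From compatible cell potentials to a global potential -/

namespace IsSquareMesh

variable {ι : Type*} {Ω : Set Plane} {z : ι → Fin 4 → Plane} (hM : IsSquareMesh Ω z)
include hM

open Topology Filter in
/-- Compatible local potentials on the cells of a simply connected domain can be shifted by
constants so as to agree in the domain. -/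
theorem exists_shift_of_increment_eq [Finite ι] (hΩ : IsSimplyConnected Ω) {F : ι → Plane → ℝ}
    (hF : ∀ i j x y, x ∈ cell (z i) → x ∈ cell (z j) → y ∈ cell (z i) → y ∈ cell (z j) →
      F i y - F i x = F j y - F j x) :
    ∃ c : ι → ℝ, ∀ i j, ∀ y ∈ Ω, y ∈ cell (z i) → y ∈ cell (z j) → F i y + c i = F j y + c j := by
  classical
  have := hΩ.simplyConnectedSpace
  have := hM.isOpen.locallyPathConnectedSpace
  -- The open star of `x`: every cell through `w` already contains `x`. It is open because finitely
  -- many closed cells miss `x`.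
  let U : Ω → Set Ω := fun x => {w | ∀ i, w.1 ∈ cell (z i) → x.1 ∈ cell (z i)}
  have hU : ∀ x, IsOpen (U x) := by
    intro x
    have : U x = Subtype.val ⁻¹' ⋂ i : {i // x.1 ∉ cell (z i)}, (cell (z i))ᶜ := by
      ext w
      simp only [U, Set.mem_ofPred_eq, mem_preimage, mem_iInter, mem_compl_iff, Subtype.forall]
      exact forall_congr' fun i => not_imp_not.symm
    rw [this]
    have hW : IsOpen (⋂ i : {i // x.1 ∉ cell (z i)}, (cell (z i.1))ᶜ) :=
      isOpen_iInter_of_finite fun i => (isCompact_cell (z i.1)).isClosed.isOpen_compl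
    exact hW.preimage continuous_subtype_val
  -- The local potential normalised to vanish at `x`. By `hF` the chosen cell does not matter, and
  -- for `w` in `U x` the default 0 never occurs.
  let f : Ω → Ω → ℝ := fun x w =>
    if h : ∃ i, x.1 ∈ cell (z i) ∧ w.1 ∈ cell (z i) then F h.choose w - F h.choose x else 0
  have hf : ∀ (x w : Ω) i, x.1 ∈ cell (z i) → w.1 ∈ cell (z i) → f x w = F i w - F i x := by
    intro x w i hx hw
    have h : ∃ i, x.1 ∈ cell (z i) ∧ w.1 ∈ cell (z i) := ⟨i, hx, hw⟩
    simp only [f, dif_pos h]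
    exact hF _ _ _ _ h.choose_spec.1 hx h.choose_spec.2 hw
  obtain ⟨B, hB⟩ := exists_potential_of_isSimplyConnected U hU (fun x i h => h) f (by
    rintro x x' y ⟨hy, hy'⟩
    filter_upwards [(hU y).mem_nhds (fun i h => h), (hU x).mem_nhds hy, (hU x').mem_nhds hy']
      with w h h' h''
    obtain ⟨i, hi⟩ := hM.exists_mem_cell w.2
    rw [hf x w i (h' i hi) hi, hf x' w i (h'' i hi) hi, hf x y i (h' i hi) (h i hi),
      hf x' y i (h'' i hi) (h i hi)]
    ring)
  have hloc : ∀ y : Ω, ∀ᶠ w in 𝓝 y, ∀ i, w.1 ∈ cell (z i) → B w - F i w = B y - F i y := by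
    intro y
    filter_upwards [hB y y (fun i h => h), (hU y).mem_nhds (fun i h => h)] with w hw hwU i hi
    rw [hf y w i (hwU i hi) hi, hf y y i (hwU i hi) (hwU i hi)] at hw
    linarith
  -- The difference is locally constant on the interior of the cell, which is convex and thus
  -- connected.
  have hconst : ∀ i, ∃ c, ∀ w : Ω, w.1 ∈ interior (cell (z i)) → B w - F i w = c := by
    intro i
    let V := interior (cell (z i))
    have hpre : PreconnectedSpace V :=
      Subtype.preconnectedSpace (hM.square i).convex_cell.interior.isPreconnected
    let inc : V → Ω := fun w => ⟨w.1, hM.interior_cell_subset i w.2⟩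
    have hinc : Continuous inc := by fun_prop
    have hlc : IsLocallyConstant fun w : V => B (inc w) - F i w := by
      rw [IsLocallyConstant.iff_eventually_eq]
      intro w
      filter_upwards [hinc.continuousAt.eventually (hloc (inc w))] with w' hw'
      exact hw' i (interior_subset w'.2)
    by_cases hne : Nonempty V
    · obtain ⟨w₀⟩ := hne
      exact ⟨B (inc w₀) - F i w₀, fun w hw =>
        hlc.apply_eq_of_preconnectedSpace ⟨w.1, hw⟩ w₀⟩
    · exact ⟨0, fun w hw => (hne ⟨⟨w.1, hw⟩⟩).elim⟩
  choose c hc using hconst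
  -- The interior is dense in the cell, and near `y` the difference keeps its value at `y`
  -- throughout the cell; so the constant extends to all points of the cell in Ω.
  have hval : ∀ i (y : Ω), y.1 ∈ cell (z i) → F i y + c i = B y := by
    intro i y hy
    have hev := hloc y
    rw [nhds_subtype_eq_comap, eventually_comap] at hev
    obtain ⟨w, hw, hwV⟩ := mem_closure_iff_nhds.1
      ((hM.square i).closure_interior_cell.symm ▸ hy) _ hev
    have h1 := hw ⟨w, hM.interior_cell_subset i hwV⟩ rfl i (interior_subset hwV)
    have h2 := hc i ⟨w, hM.interior_cell_subset i hwV⟩ hwV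
    linarith
  exact ⟨c, fun i j y hy hi hj => (hval i ⟨y, hy⟩ hi).trans (hval j ⟨y, hy⟩ hj).symm⟩

/-- Orthogonality makes the local potentials of τ compatible, simple connectedness glues them, and
the glued function, shifted to mean zero, is a conforming potential of τ. -/
theorem mem_curlVQ_of_orthogonal [Finite ι] (hΩ : IsSimplyConnected Ω) {τ : L2 Ω Plane}
    (hτ : τ ∈ spaceX 1 Ω z) (horth : ∀ g ∈ gradNC Ω z, inner ℝ g τ = 0) : τ ∈ curlVQ 1 Ω z := by
  have := hM.isFiniteMeasure
  choose β hβ hτβ using (mem_spaceX_one_iff hM.square).1 hτ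
  obtain ⟨c, hc⟩ := hM.exists_shift_of_increment_eq (F := fun i => cellFun (z i) (β i)) hΩ
    (fun i j x y hxi hxj hyi hyj => hM.increment_eq hβ hτβ horth i j hxi hxj hyi hyj)
  obtain ⟨u₀, hu₀⟩ := hM.exists_piecewise (fun i => cellFun (z i) (β i + ![c i, 0, 0, 0, 0]))
    fun i => continuous_cellFun _ _
  -- The mean value of the glued potential over Ω; subtracting it changes only the constant
  -- coefficients.
  set m : ℝ := ((volume.restrict Ω).real univ)⁻¹ * ∫ y in Ω, u₀ y with hm
  obtain ⟨u, hu⟩ := hM.exists_piecewise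
    (fun i => cellFun (z i) (β i + ![c i - m, 0, 0, 0, 0])) fun i => continuous_cellFun _ _
  obtain ⟨g, hg⟩ := hM.exists_piecewise (fun i => cellGrad (z i) (β i))
    fun i => continuous_cellGrad _ _
  have hug : HasWeakGradient Ω Ω u g := by
    refine hM.hasWeakGradient_of_continuous hu
      (fun i => (hg i).congr fun y _ => (cellGrad_add_const _ _ _ _).symm) ?_
    intro i j y hy hi hj
    simp only [cellFun_add, cellFun_const]
    linarith [hc i j y hy hi hj]
  have hcell : ∀ᵐ y ∂(volume : Measure Plane).restrict Ω, ∃ i, y ∈ cell (z i) := by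
    filter_upwards [ae_restrict_mem hM.isOpen.measurableSet] with y hy
    exact hM.exists_mem_cell hy
  have hint₀ : Integrable u₀ (volume.restrict Ω) := (Lp.memLp u₀).integrable one_le_two
  have hmean : ∫ y in Ω, u y = 0 := by
    have h1 : ∀ᵐ y ∂(volume : Measure Plane).restrict Ω, u y = u₀ y - m := by
      filter_upwards [ae_all_iff.2 hu₀, ae_all_iff.2 hu, hcell] with y h1 h2 ⟨i, hi⟩
      rw [h1 i hi, h2 i hi]
      simp only [cellFun_add, cellFun_const]
      ring
    have hpos : (volume.restrict Ω).real univ ≠ 0 := by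
      rw [measureReal_def, ENNReal.toReal_ne_zero, Measure.restrict_apply_univ]
      refine ⟨(hM.isOpen.measure_pos volume hΩ.nonempty).ne', ?_⟩
      have := measure_ne_top ((volume : Measure Plane).restrict Ω) univ
      rwa [Measure.restrict_apply_univ] at this
    rw [integral_congr_ae h1, integral_sub hint₀ (integrable_const _), integral_const, smul_eq_mul,
      hm, mul_inv_cancel_left₀ hpos, sub_self]
  refine ⟨u, (mem_spaceVQ_one_iff hM.square).2 ⟨⟨⟨g, hug⟩,
    (Lp.memLp u).integrable one_le_two, hmean⟩, fun i => ⟨_, ?_, hu i⟩⟩, g, hug, ?_⟩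
  · simp [hβ i]
  · filter_upwards [ae_all_iff.2 hτβ, ae_all_iff.2 hg, hcell] with y h1 h2 ⟨i, hi⟩
    rw [h1 i hi, h2 i hi]
    rfl

end IsSquareMesh

/-! ### The decomposition -/

theorem theorem4p2 {ι : Type*} [Finite ι] (Ω : Set Plane) (hΩ_open : IsOpen Ω)
    (hΩ_bounded : Bornology.IsBounded Ω) (hΩ_simply : IsSimplyConnected Ω)
    (hΩ_lipschitz : HasLipschitzBoundary Ω) (z : ι → Fin 4 → Plane)
    (hz_square : ∀ i, IsSquareCell (z i)) (hz_partition : IsRegularPartition Ω z) :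
    spaceX 1 Ω z = gradNC Ω z ⊔ curlVQ 1 Ω z ∧
      Disjoint (gradNC Ω z) (curlVQ 1 Ω z) ∧
      gradNC Ω z ⟂ curlVQ 1 Ω z := by
  have hM : IsSquareMesh Ω z :=
    ⟨hΩ_open, hΩ_lipschitz.interior_closure hΩ_open, hz_square, hz_partition⟩
  have horth := hM.gradNC_isOrtho_curlVQ
  refine ⟨le_antisymm (fun τ hτ => ?_) (sup_le hM.gradNC_le_spaceX hM.curlVQ_le_spaceX),
    horth.disjoint, horth⟩
  have := hM.finiteDimensional_spaceX
  have : FiniteDimensional ℝ (gradNC Ω z) :=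
    Submodule.finiteDimensional_of_le hM.gradNC_le_spaceX
  -- The remainder `c` is orthogonal to all nonconforming gradients and, as a difference of two
  -- elements of X_1, still lies in X_1; hence it is a Curl.
  obtain ⟨g, hg, c, hc, rfl⟩ := Submodule.exists_add_mem_mem_orthogonal (K := gradNC Ω z) τ
  refine Submodule.add_mem_sup hg (hM.mem_curlVQ_of_orthogonal hΩ_simply ?_
    fun g' hg' => (Submodule.mem_orthogonal _ _).1 hc g' hg')
  have := Submodule.sub_mem _ hτ (hM.gradNC_le_spaceX hg)
  rwa [add_sub_cancel_left] at this
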